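/- Let $\mathbb T\subseteq\mathbb R$ be a time scale (a nonempty closed set), with forward jump $\sigma(t)=\inf\{s\in\mathbb T:s>t\}$ and graininess $\mu(t)=\sigma(t)-t$. Let $T>0$ and suppose that $\mathbb T$ is $T$-periodic: $t+T\in\mathbb T$ and $\mu(t+T)=\mu(t)$ for all $t\in\mathbb T$. Let $p,q:\mathbb T\to\mathbb R$ be rd-continuous and $T$-periodic, with $1-\mu(t)p(t)+\mu(t)^2q(t)\neq0$ for all $t\in\mathbb T$, and consider the equation $$x^{\Delta\Delta}+p(t)x^{\Delta}+q(t)x=0,\qquad\text{that is,}\qquad x^\Delta=y,\quad y^\Delta=-q(t)x-p(t)y,\tag{1}$$ on $\mathbb T$. Fix $t_0\in\mathbb T$, let $(x_1,y_1)$ and $(x_2,y_2)$ be the solutions of (1) on $\mathbb T$ with $(x_1,y_1)(t_0)=(1,0)$ and $(x_2,y_2)(t_0)=(0,1)$, and let $$M=\begin{pmatrix}x_1(t_0+T)&x_2(t_0+T)\\ y_1(t_0+T)&y_2(t_0+T)\end{pmatrix}$$ be the monodromy matrix, whose eigenvalues are the Floquet multipliers. Put $$\mathcal A=x_1(t_0+T)+y_2(t_0+T),\qquad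 \mathcal B=e_{-p+\mu q}(t_0+T,t_0),\qquad \rho_{1,2}=\frac{\mathcal A}{2}\pm\sqrt{\Big(\frac{\mathcal A}{2}\Big)^2-\mathcal B}\in\mathbb C,$$ where $e_r(t,s)=\exp\Big(\int_s^t\xi_{\mu(\tau)}(r(\tau))\,\Delta\tau\Big)$ is the time scale exponential, with $\xi_h(z)=\mathrm{Log}(1+hz)/h$ for $h>0$ and $\xi_0(z)=z$. Then $\mathcal A=\operatorname{tr}M$, $\mathcal B=\det M$, and the Floquet multipliers, counted with algebraic multiplicity, are $\rho_1,\rho_2$. Moreover: (i) if $|\rho_1|<1$ and $|\rho_2|<1$, then (1) is stable; (ii) if $|\rho_1|>1$ or $|\rho_2|>1$, then (1) is unstable. Here (1) is called stable from $s\in\mathbb T$ if for every $\varepsilon>0$ there is $\delta>0$ such that every solution of (1) on $\mathbb T\cap[s,\infty)$ with $|x(s)|<\delta$ and $|x^\Delta(s)|<\delta$ satisfies $|x(t)|<\varepsilon$ and $|x^\Delta(t)|<\varepsilon$ for all $t\in\mathbb T$, $t\ge s$. In (i) it is stable from every $s\in\mathbb T$, and in (ii) it is not stable from any $s\in\mathbb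 T$. -/

import Mathlib

open scoped Topology

/-- A time scale is a nonempty closed subset of the real line. Functions on a time scale `𝕋` are
represented by functions on `ℝ` of which only the values on `𝕋` are ever used. -/
structure IsTimeScale (𝕋 : Set ℝ) : Prop where
  nonempty : 𝕋.Nonempty
  isClosed : IsClosed 𝕋

open Classical in
/-- The forward jump operator `σ(t) = inf {s ∈ 𝕋 : s > t}`, with `inf ∅ = sup 𝕋`. -/
noncomputable def forwardJump (𝕋 : Set ℝ) (t : ℝ) : ℝ :=
  if (𝕋 ∩ Set.Ioi t).Nonempty then sInf (𝕋 ∩ Set.Ioi t) else sSup 𝕋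

open Classical in
/-- The backward jump operator `ρ(t) = sup {s ∈ 𝕋 : s < t}`, with `sup ∅ = inf 𝕋`. -/
noncomputable def backwardJump (𝕋 : Set ℝ) (t : ℝ) : ℝ :=
  if (𝕋 ∩ Set.Iio t).Nonempty then sSup (𝕋 ∩ Set.Iio t) else sInf 𝕋

/-- The graininess `μ(t) = σ(t) - t`. -/
noncomputable def graininess (𝕋 : Set ℝ) (t : ℝ) : ℝ :=
  forwardJump 𝕋 t - t

/-- A time scale is `T`-periodic, `T > 0`, if `t + T ∈ 𝕋` and `μ(t + T) = μ(t)` for all `t ∈ 𝕋`. -/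
structure IsPeriodicTimeScale (𝕋 : Set ℝ) (T : ℝ) : Prop where
  pos : 0 < T
  add_mem : ∀ t ∈ 𝕋, t + T ∈ 𝕋
  graininess_add : ∀ t ∈ 𝕋, graininess 𝕋 t = graininess 𝕋 (t + T)

/-- Rd-continuity: continuity (along `𝕋`) at the right-dense points, and finite left-sided limits
at the left-dense points. -/
structure RdContinuous (𝕋 : Set ℝ) (f : ℝ → ℝ) : Prop where
  rightDense : ∀ t ∈ 𝕋, forwardJump 𝕋 t = t → ContinuousWithinAt f 𝕋 t
  leftDense : ∀ t ∈ 𝕋, backwardJump 𝕋 t = t →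
    ∃ l : ℝ, Filter.Tendsto f (𝓝[𝕋 ∩ Set.Iio t] t) (𝓝 l)

/-- `f' = f^Δ(t)`: for every `ε > 0` there is a neighbourhood `U` of `t` such that
`‖f(σ(t)) - f(s) - (σ(t) - s) f'‖ ≤ ε |σ(t) - s|` for all `s ∈ U ∩ 𝕋`. -/
def HasDeltaDerivAt {E : Type*} [NormedAddCommGroup E] [NormedSpace ℝ E]
    (𝕋 : Set ℝ) (f : ℝ → E) (f' : E) (t : ℝ) : Prop :=
  ∀ ε > 0, ∀ᶠ s in 𝓝[𝕋] t,
    ‖f (forwardJump 𝕋 t) - f s - (forwardJump 𝕋 t - s) • f'‖ ≤ ε * |forwardJump 𝕋 t - s|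

/-- `F` is an antiderivative of `f` on `𝕋`. (At a left-scattered maximum of `𝕋` the condition
is void.) -/
def IsDeltaAntideriv (𝕋 : Set ℝ) (f F : ℝ → ℂ) : Prop :=
  ∀ t ∈ 𝕋, HasDeltaDerivAt 𝕋 F (f t) t

open Classical in
/-- The Cauchy integral `∫_a^b f(τ) Δτ = F(b) - F(a)`, for any antiderivative `F` of `f`
(one exists as soon as `f` is rd-continuous). -/
noncomputable def deltaIntegral (𝕋 : Set ℝ) (f : ℝ → ℂ) (a b : ℝ) : ℂ :=
  if h : ∃ F : ℝ → ℂ, IsDeltaAntideriv 𝕋 f F then h.choose b - h.choose a else 0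

open Classical in
/-- The cylinder transformation: `Log (1 + h z) / h` for `h ≠ 0`, and its limit `z` for `h = 0`. -/
noncomputable def cylinderTransform (h : ℝ) (z : ℂ) : ℂ :=
  if h = 0 then z else Complex.log (1 + h * z) / h

/-- The exponential function `e_r(t, s)` of a regressive rd-continuous function `r`. -/
noncomputable def timeScaleExp (𝕋 : Set ℝ) (r : ℝ → ℝ) (t s : ℝ) : ℂ :=
  Complex.exp (deltaIntegral 𝕋 (fun τ => cylinderTransform (graininess 𝕋 τ) (r τ)) s t)

/-- `x` solves `x^{ΔΔ} + p x^Δ + q x = 0` on `𝕋`, and `y = x^Δ`. -/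
structure IsSolution (𝕋 : Set ℝ) (p q : ℝ → ℝ) (x y : ℝ → ℝ) : Prop where
  deriv_fst : ∀ t ∈ 𝕋, HasDeltaDerivAt 𝕋 x (y t) t
  deriv_snd : ∀ t ∈ 𝕋, HasDeltaDerivAt 𝕋 y (-q t * x t - p t * y t) t

/-- Lyapunov stability, for the initial time `s`, of the zero solution of
`x^{ΔΔ} + p x^Δ + q x = 0`, in the phase variables `(x, x^Δ)`. -/
def IsStableFrom (𝕋 : Set ℝ) (p q : ℝ → ℝ) (s : ℝ) : Prop :=
  ∀ ε > 0, ∃ δ > 0, ∀ x y : ℝ → ℝ, IsSolution (𝕋 ∩ Set.Ici s) p q x y →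
    |x s| < δ → |y s| < δ → ∀ t ∈ 𝕋, s ≤ t → |x t| < ε ∧ |y t| < ε

/-!
The theorem rests on three facts about a time scale `𝕋` that is unbounded above, as every periodic
one is.

*Forward uniqueness.* Induction along `𝕋` (`timeScale_induction`) gives a Grönwall inequality
(`norm_le_mul_exp_of_norm_deltaDeriv_le`); rd-continuous coefficients are bounded on compact
intervals, so the solutions on `[s, b]` are bounded by their initial values at `s`
(`exists_bound_of_isSolution`) and determined by them.

*Liouville's formula.* The Wronskian satisfies `W^Δ = (-p + μ q) W`. The cylinder transform of a
regressive rd-continuous function has an antiderivative `F`, namely the Lebesgue integral of its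
extension by constants over the gaps (`HasRdLimits.exists_isDeltaAntideriv`), and `exp (-F) W` has
delta derivative zero, hence is constant (`eq_timeScaleExp_mul`). This identifies `det M` with the
time scale exponential, and the roots of `z² - (tr M) z + det M` with `ρ₁, ρ₂`.

*The monodromy recurrence.* Translates of solutions by the period are solutions, so by uniqueness
and the Cayley–Hamilton theorem every solution satisfies
`x (t + 2T) = (tr M) x (t + T) - (det M) x t` from some `t₀ + k T` on
(`IsFundamentalSystem.recurrence`). For roots inside the unit disc such sequences are
bounded by their first two terms, and the Grönwall inequality controls those. If `|ρ₁| > 1`, stability would bound all solutions, and a bounded sequence of this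
kind satisfies `a (n + 1) = ρ₂ a n`; applied to the diagonal of the fundamental matrix this gives
`M` the diagonal entries `ρ₂, ρ₂`, so `ρ₁ = ρ₂` by the trace, and then `x₁ (t₀ + n T) = ρ₁ ^ n` is
unbounded.
-/

open Set Filter

/-! ### The forward jump on a time scale that is unbounded above -/

section ForwardJump

variable {𝕋 : Set ℝ}

lemma nonempty_inter_Ioi (hub : ¬ BddAbove 𝕋) (t : ℝ) : (𝕋 ∩ Ioi t).Nonempty := by
  obtain ⟨s, hs, hts⟩ := not_bddAbove_iff.1 hub t
  exact ⟨s, hs, hts⟩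

lemma bddBelow_inter_Ioi (t : ℝ) : BddBelow (𝕋 ∩ Ioi t) :=
  ⟨t, fun _ hs => le_of_lt hs.2⟩

lemma forwardJump_eq_sInf (hub : ¬ BddAbove 𝕋) (t : ℝ) :
    forwardJump 𝕋 t = sInf (𝕋 ∩ Ioi t) := if_pos (nonempty_inter_Ioi hub t)

lemma le_forwardJump (hub : ¬ BddAbove 𝕋) (t : ℝ) : t ≤ forwardJump 𝕋 t := by
  rw [forwardJump_eq_sInf hub]
  exact le_csInf (nonempty_inter_Ioi hub t) fun s hs => le_of_lt hs.2

lemma graininess_nonneg (hub : ¬ BddAbove 𝕋) (t : ℝ) : 0 ≤ graininess 𝕋 t :=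
  sub_nonneg.2 (le_forwardJump hub t)

lemma forwardJump_le (hub : ¬ BddAbove 𝕋) {s t : ℝ} (hs : s ∈ 𝕋) (hts : t < s) :
    forwardJump 𝕋 t ≤ s := by
  rw [forwardJump_eq_sInf hub]
  exact csInf_le (bddBelow_inter_Ioi t) ⟨hs, hts⟩

lemma forwardJump_mem (hc : IsClosed 𝕋) (hub : ¬ BddAbove 𝕋) (t : ℝ) : forwardJump 𝕋 t ∈ 𝕋 := by
  rw [forwardJump_eq_sInf hub]
  have h := csInf_mem_closure (nonempty_inter_Ioi hub t) (bddBelow_inter_Ioi t)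
  exact closure_minimal inter_subset_left hc h

lemma exists_mem_Ioo_of_forwardJump_lt (hub : ¬ BddAbove 𝕋) {t u : ℝ}
    (h : forwardJump 𝕋 t < u) : ∃ s ∈ 𝕋, t < s ∧ s < u := by
  rw [forwardJump_eq_sInf hub] at h
  obtain ⟨s, hs, hsu⟩ := exists_lt_of_csInf_lt (nonempty_inter_Ioi hub t) h
  exact ⟨s, hs.1, hs.2, hsu⟩

/-- At a right-scattered point, the time scale lies locally to the left. -/
lemma eventually_le_of_lt_forwardJump (hub : ¬ BddAbove 𝕋) {t : ℝ} (h : t < forwardJump 𝕋 t) :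
    ∀ᶠ s in 𝓝[𝕋] t, s ≤ t := by
  filter_upwards [self_mem_nhdsWithin, mem_nhdsWithin_of_mem_nhds (Iio_mem_nhds h)] with s hs hst
  by_contra! hts
  exact absurd (forwardJump_le hub hs hts) (not_le.2 hst)

lemma not_bddAbove_inter_Ici (hub : ¬ BddAbove 𝕋) (s : ℝ) : ¬ BddAbove (𝕋 ∩ Ici s) := by
  rw [not_bddAbove_iff]
  intro t
  obtain ⟨u, hu, h⟩ := not_bddAbove_iff.1 hub (max s t)
  exact ⟨u, ⟨hu, (lt_of_le_of_lt (le_max_left _ _) h).le⟩, lt_of_le_of_lt (le_max_right _ _) h⟩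

lemma forwardJump_inter_Ici (hub : ¬ BddAbove 𝕋) {s t : ℝ} (hst : s ≤ t) :
    forwardJump (𝕋 ∩ Ici s) t = forwardJump 𝕋 t := by
  rw [forwardJump_eq_sInf hub, forwardJump_eq_sInf (not_bddAbove_inter_Ici hub s)]
  congr 1
  ext u
  simp only [mem_inter_iff, mem_Ici, mem_Ioi]
  exact ⟨fun h => ⟨h.1.1, h.2⟩, fun h => ⟨⟨h.1, hst.trans h.2.le⟩, h.2⟩⟩

/-- A point that is not the first one is either the jump of its predecessor or a limit of the time
scale from the left. -/
lemma exists_forwardJump_eq_or_left_limit (hc : IsClosed 𝕋) (hub : ¬ BddAbove 𝕋) {a t : ℝ}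
    (ha : a ∈ 𝕋) (ht : t ∈ 𝕋) (hat : a < t) :
    (∃ r ∈ 𝕋, a ≤ r ∧ r < t ∧ forwardJump 𝕋 r = t) ∨ ∃ᶠ s in 𝓝[𝕋] t, a ≤ s ∧ s < t := by
  have hne : (𝕋 ∩ Iio t).Nonempty := ⟨a, ha, hat⟩
  have hbdd : BddAbove (𝕋 ∩ Iio t) := ⟨t, fun _ hs => le_of_lt hs.2⟩
  set r := sSup (𝕋 ∩ Iio t) with hr
  have hr𝕋 : r ∈ 𝕋 := closure_minimal inter_subset_left hc (csSup_mem_closure hne hbdd)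
  have har : a ≤ r := le_csSup hbdd ⟨ha, hat⟩
  have hrt : r ≤ t := csSup_le hne fun s hs => le_of_lt hs.2
  rcases hrt.lt_or_eq with hlt | heq
  · left
    refine ⟨r, hr𝕋, har, hlt, le_antisymm (forwardJump_le hub ht hlt) ?_⟩
    by_contra! h
    obtain ⟨s, hs, hrs, hst⟩ := exists_mem_Ioo_of_forwardJump_lt hub h
    exact absurd (le_csSup hbdd ⟨hs, hst⟩) (not_le.2 hrs)
  · right
    rw [Filter.frequently_iff]
    intro U hU
    obtain ⟨V, hV, hVU⟩ := mem_nhdsWithin_iff_exists_mem_nhds_inter.1 hU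
    obtain ⟨l, hl, hlV⟩ := exists_Ioc_subset_of_mem_nhds' hV hat
    have : l < sSup (𝕋 ∩ Iio t) := by rw [← hr, heq]; exact hl.2
    obtain ⟨s, hs, hls⟩ := exists_lt_of_lt_csSup hne this
    exact ⟨s, hVU ⟨hlV ⟨hls, le_of_lt hs.2⟩, hs.1⟩, hl.1.trans hls.le, hs.2⟩

/-- Induction along a time scale: a property of the starting point that is inherited across gaps,
propagates to the right of right-dense points, and passes to limits from the left, holds from the
starting point on. -/
theorem timeScale_induction (hc : IsClosed 𝕋) (hub : ¬ BddAbove 𝕋) {a : ℝ} (ha : a ∈ 𝕋)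
    {P : ℝ → Prop} (base : P a)
    (jump : ∀ t ∈ 𝕋, a ≤ t → t < forwardJump 𝕋 t → P t → P (forwardJump 𝕋 t))
    (right : ∀ t ∈ 𝕋, a ≤ t → forwardJump 𝕋 t = t → P t → ∀ᶠ s in 𝓝[𝕋] t, t < s → P s)
    (left : ∀ t ∈ 𝕋, a < t → (∃ᶠ s in 𝓝[𝕋] t, s < t ∧ P s) → P t) :
    ∀ t ∈ 𝕋, a ≤ t → P t := by
  by_contra! hbad
  set S := {t | t ∈ 𝕋 ∧ a ≤ t ∧ ¬ P t} with hS
  have hne : S.Nonempty := by obtain ⟨t, h1, h2, h3⟩ := hbad; exact ⟨t, h1, h2, h3⟩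
  have hbdd : BddBelow S := ⟨a, fun t ht => ht.2.1⟩
  set c := sInf S with hcdef
  have hc𝕋 : c ∈ 𝕋 := closure_minimal (fun t ht => ht.1) hc (csInf_mem_closure hne hbdd)
  have hac : a ≤ c := le_csInf hne fun t ht => ht.2.1
  have hlow : ∀ t ∈ 𝕋, a ≤ t → t < c → P t := fun t h1 h2 h3 => by
    by_contra h
    exact absurd (csInf_le hbdd ⟨h1, h2, h⟩) (not_le.2 h3)
  have hPc : P c := by
    rcases hac.eq_or_lt with h | h
    · rwa [← h]
    · rcases exists_forwardJump_eq_or_left_limit hc hub ha hc𝕋 h with ⟨r, hr, har, hrc, hj⟩ | hfr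
      · rw [← hj]
        exact jump r hr har (by rwa [hj]) (hlow r hr har hrc)
      · exact left c hc𝕋 h ((hfr.and_eventually self_mem_nhdsWithin).mono
          fun s hs => ⟨hs.1.2, hlow s hs.2 hs.1.1 hs.1.2⟩)
  have hltS : ∀ t ∈ S, c < t := fun t ht =>
    lt_of_le_of_ne (csInf_le hbdd ht) fun h => ht.2.2 (h ▸ hPc)
  have hdense : forwardJump 𝕋 c = c := by
    refine le_antisymm (le_csInf hne fun t ht => forwardJump_le hub ht.1 (hltS t ht))
      (le_forwardJump hub c)
  have hev := right c hc𝕋 hac hdense hPc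
  obtain ⟨u, hu, hsub⟩ := Metric.mem_nhdsWithin_iff.1 hev
  obtain ⟨t, ht, htu⟩ := exists_lt_of_csInf_lt hne (show sInf S < c + u by rw [← hcdef]; linarith)
  refine ht.2.2 (hsub ⟨?_, ht.1⟩ (hltS t ht))
  rw [Metric.mem_ball, Real.dist_eq, abs_of_pos (sub_pos.2 (hltS t ht))]
  linarith

end ForwardJump

/-! ### The delta derivative -/

section DeltaDeriv

variable {𝕋 : Set ℝ} {E : Type*} [NormedAddCommGroup E] [NormedSpace ℝ E]
  {f : ℝ → E} {f' : E} {t : ℝ}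

lemma HasDeltaDerivAt.apply_forwardJump (h : HasDeltaDerivAt 𝕋 f f' t) (ht : t ∈ 𝕋) :
    f (forwardJump 𝕋 t) = f t + graininess 𝕋 t • f' := by
  rw [← sub_eq_zero, ← norm_le_zero_iff]
  have key : ∀ ε > 0, ‖f (forwardJump 𝕋 t) - (f t + graininess 𝕋 t • f')‖ ≤
      ε * |graininess 𝕋 t| := fun ε hε => by
    have := (h ε hε).self_of_nhdsWithin ht
    rwa [sub_sub] at this
  have hlim : Tendsto (fun ε : ℝ => ε * |graininess 𝕋 t|) (𝓝[>] 0) (𝓝 0) := by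
    have : Tendsto (fun ε : ℝ => ε * |graininess 𝕋 t|) (𝓝 0) (𝓝 (0 * |graininess 𝕋 t|)) :=
      (continuous_id.mul continuous_const).tendsto 0
    rw [zero_mul] at this
    exact this.mono_left nhdsWithin_le_nhds
  exact ge_of_tendsto hlim (by filter_upwards [self_mem_nhdsWithin] with ε hε using key ε hε)

lemma HasDeltaDerivAt.continuousWithinAt (h : HasDeltaDerivAt 𝕋 f f' t) (ht : t ∈ 𝕋) :
    ContinuousWithinAt f 𝕋 t := by
  rw [ContinuousWithinAt, tendsto_iff_norm_sub_tendsto_zero, Metric.tendsto_nhds]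
  intro ε hε
  set m := |graininess 𝕋 t| + 1
  have hm : 0 < m := by positivity
  have hsmall : ∀ᶠ s in 𝓝[𝕋] t, |t - s| < min 1 (ε / (2 * (‖f'‖ + 1))) := by
    apply mem_nhdsWithin_of_mem_nhds
    have : Tendsto (fun s => |t - s|) (𝓝 t) (𝓝 |t - t|) :=
      (continuous_const.sub continuous_id).abs.tendsto t
    rw [sub_self, abs_zero] at this
    exact this.eventually (gt_mem_nhds (by positivity))
  filter_upwards [h (ε / (2 * m)) (by positivity), hsmall] with s hs hst
  rw [lt_min_iff] at hst
  rw [Real.dist_eq, sub_zero, abs_of_nonneg (norm_nonneg _)]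
  have hσ : forwardJump 𝕋 t - s = graininess 𝕋 t + (t - s) := by simp [graininess]
  have e : f s - f t =
      (t - s) • (-f') - (f (forwardJump 𝕋 t) - f s - (forwardJump 𝕋 t - s) • f') := by
    rw [h.apply_forwardJump ht, hσ, add_smul, smul_neg]
    abel
  have h1 : |forwardJump 𝕋 t - s| ≤ m := by
    rw [hσ]
    exact (abs_add_le _ _).trans (by simp only [m]; linarith [hst.1])
  have h2 : ε / (2 * m) * |forwardJump 𝕋 t - s| ≤ ε / 2 :=
    (mul_le_mul_of_nonneg_left h1 (by positivity)).trans (le_of_eq (by field_simp))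
  have h3 : |t - s| * ‖f'‖ < ε / 2 := by
    have : |t - s| * (‖f'‖ + 1) < ε / 2 := by
      have := (lt_div_iff₀ (by positivity)).1 hst.2
      linarith
    nlinarith [abs_nonneg (t - s)]
  calc ‖f s - f t‖ ≤ ‖(t - s) • (-f')‖ + ‖f (forwardJump 𝕋 t) - f s -
        (forwardJump 𝕋 t - s) • f'‖ := by rw [e]; exact norm_sub_le _ _
    _ ≤ |t - s| * ‖f'‖ + ε / 2 := by
        rw [norm_smul, norm_neg, Real.norm_eq_abs]
        linarith
    _ < ε := by linarith

/-- At a right-dense point the delta derivative is the derivative along the time scale. -/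
lemma hasDeltaDerivAt_iff_of_rightDense (h : forwardJump 𝕋 t = t) :
    HasDeltaDerivAt 𝕋 f f' t ↔ HasDerivWithinAt f f' 𝕋 t := by
  rw [hasDerivWithinAt_iff_isLittleO, Asymptotics.isLittleO_iff]
  unfold HasDeltaDerivAt
  rw [h]
  refine forall₂_congr fun ε hε => eventually_congr (Eventually.of_forall fun s => ?_)
  have e : f s - f t - (s - t) • f' = -(f t - f s - (t - s) • f') := by
    rw [← neg_sub t s, neg_smul]; abel
  rw [e, norm_neg, Real.norm_eq_abs, abs_sub_comm s t]

/-- At a right-scattered point a delta derivative amounts to continuity and the value at the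
jump. -/
lemma hasDeltaDerivAt_of_rightScattered (h : t < forwardJump 𝕋 t)
    (hcont : ContinuousWithinAt f 𝕋 t)
    (hjump : f (forwardJump 𝕋 t) = f t + graininess 𝕋 t • f') : HasDeltaDerivAt 𝕋 f f' t := by
  intro ε hε
  have hl : Tendsto (fun s => ‖f (forwardJump 𝕋 t) - f s - (forwardJump 𝕋 t - s) • f'‖ -
      ε * |forwardJump 𝕋 t - s|) (𝓝[𝕋] t)
      (𝓝 (‖f (forwardJump 𝕋 t) - f t - (forwardJump 𝕋 t - t) • f'‖ -
        ε * |forwardJump 𝕋 t - t|)) := by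
    have hid : Tendsto (fun s : ℝ => forwardJump 𝕋 t - s) (𝓝[𝕋] t)
        (𝓝 (forwardJump 𝕋 t - t)) :=
      ((continuous_const.sub continuous_id).tendsto t).mono_left nhdsWithin_le_nhds
    exact ((tendsto_const_nhds.sub hcont).sub (hid.smul_const f')).norm.sub
      (hid.abs.const_mul ε)
  have h0 : ‖f (forwardJump 𝕋 t) - f t - (forwardJump 𝕋 t - t) • f'‖ -
      ε * |forwardJump 𝕋 t - t| < 0 := by
    rw [hjump, graininess, add_sub_cancel_left, sub_self, norm_zero, zero_sub, neg_lt_zero,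
      abs_of_pos (sub_pos.2 h)]
    exact mul_pos hε (sub_pos.2 h)
  filter_upwards [hl.eventually (gt_mem_nhds h0)] with s hs
  linarith

/-- The delta derivative splits into its right-dense and right-scattered cases. -/
lemma hasDeltaDerivAt_of_cases (hub : ¬ BddAbove 𝕋) (hcont : ContinuousWithinAt f 𝕋 t)
    (hjump : f (forwardJump 𝕋 t) = f t + graininess 𝕋 t • f')
    (hdense : forwardJump 𝕋 t = t → HasDerivWithinAt f f' 𝕋 t) : HasDeltaDerivAt 𝕋 f f' t := by
  rcases (le_forwardJump hub t).eq_or_lt with h | h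
  · exact (hasDeltaDerivAt_iff_of_rightDense h.symm).2 (hdense h.symm)
  · exact hasDeltaDerivAt_of_rightScattered h hcont hjump

lemma HasDeltaDerivAt.restrict_Ici (h : HasDeltaDerivAt 𝕋 f f' t) (hub : ¬ BddAbove 𝕋) {s : ℝ}
    (hst : s ≤ t) : HasDeltaDerivAt (𝕋 ∩ Ici s) f f' t := by
  intro ε hε
  rw [forwardJump_inter_Ici hub hst]
  exact (h ε hε).filter_mono (nhdsWithin_mono t inter_subset_left)

lemma HasDeltaDerivAt.prodMk {F : Type*} [NormedAddCommGroup F] [NormedSpace ℝ F]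
    {g : ℝ → F} {g' : F} (hf : HasDeltaDerivAt 𝕋 f f' t) (hg : HasDeltaDerivAt 𝕋 g g' t) :
    HasDeltaDerivAt 𝕋 (fun s => (f s, g s)) (f', g') t := by
  intro ε hε
  filter_upwards [hf ε hε, hg ε hε] with s h1 h2
  exact max_le h1 h2

lemma HasDeltaDerivAt.add {g : ℝ → E} {g' : E} (hf : HasDeltaDerivAt 𝕋 f f' t)
    (hg : HasDeltaDerivAt 𝕋 g g' t) : HasDeltaDerivAt 𝕋 (fun s => f s + g s) (f' + g') t := by
  intro ε hε
  filter_upwards [hf (ε / 2) (half_pos hε), hg (ε / 2) (half_pos hε)] with s h1 h2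
  have e : f (forwardJump 𝕋 t) + g (forwardJump 𝕋 t) - (f s + g s) -
      (forwardJump 𝕋 t - s) • (f' + g') =
      (f (forwardJump 𝕋 t) - f s - (forwardJump 𝕋 t - s) • f') +
      (g (forwardJump 𝕋 t) - g s - (forwardJump 𝕋 t - s) • g') := by
    rw [smul_add]; abel
  rw [e]
  exact (norm_add_le _ _).trans (by linarith)

lemma HasDeltaDerivAt.const_smul (c : ℝ) (hf : HasDeltaDerivAt 𝕋 f f' t) :
    HasDeltaDerivAt 𝕋 (fun s => c • f s) (c • f') t := by
  intro ε hε
  filter_upwards [hf (ε / (|c| + 1)) (by positivity)] with s h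
  have e : c • f (forwardJump 𝕋 t) - c • f s - (forwardJump 𝕋 t - s) • c • f' =
      c • (f (forwardJump 𝕋 t) - f s - (forwardJump 𝕋 t - s) • f') := by
    rw [smul_sub, smul_sub, smul_comm c]
  rw [e, norm_smul, Real.norm_eq_abs]
  calc |c| * ‖f (forwardJump 𝕋 t) - f s - (forwardJump 𝕋 t - s) • f'‖
      ≤ (|c| + 1) * (ε / (|c| + 1) * |forwardJump 𝕋 t - s|) := by gcongr; linarith
    _ = ε * |forwardJump 𝕋 t - s| := by field_simp

/-- Grönwall's inequality on a time scale: `‖f^Δ‖ ≤ L ‖f‖` gives exponential growth at most. -/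
theorem norm_le_mul_exp_of_norm_deltaDeriv_le (hc : IsClosed 𝕋) (hub : ¬ BddAbove 𝕋)
    {g : ℝ → E} {a b L : ℝ} (ha : a ∈ 𝕋) (hL : 0 ≤ L)
    (hf : ∀ t ∈ 𝕋, a ≤ t → HasDeltaDerivAt 𝕋 f (g t) t)
    (hg : ∀ t ∈ 𝕋, a ≤ t → t ≤ b → ‖g t‖ ≤ L * ‖f t‖) :
    ∀ t ∈ 𝕋, a ≤ t → t ≤ b → ‖f t‖ ≤ ‖f a‖ * Real.exp (L * (t - a)) := by
  -- a strictly larger rate and initial value leave room for the error term at right-dense points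
  have key : ∀ η > 0, ∀ t ∈ 𝕋, a ≤ t → t ≤ b →
      ‖f t‖ ≤ (‖f a‖ + η) * Real.exp ((L + η) * (t - a)) := by
    intro η hη
    refine timeScale_induction hc hub ha (fun _ => ?_) ?_ ?_ ?_
    · simp [hη.le]
    · intro t ht hat hlt hP hb
      have h1 := hP (hlt.le.trans hb)
      have h2 := hg t ht hat (hlt.le.trans hb)
      have hμ := graininess_nonneg hub t
      rw [(hf t ht hat).apply_forwardJump ht]
      have h3 : forwardJump 𝕋 t - a = (t - a) + graininess 𝕋 t := by simp [graininess]
      have h4 : 1 + (L + η) * graininess 𝕋 t ≤ Real.exp ((L + η) * graininess 𝕋 t) := by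
        linarith [Real.add_one_le_exp ((L + η) * graininess 𝕋 t)]
      rw [h3, mul_add, Real.exp_add, ← mul_assoc]
      calc ‖f t + graininess 𝕋 t • g t‖ ≤ ‖f t‖ + graininess 𝕋 t * ‖g t‖ := by
            refine (norm_add_le _ _).trans ?_
            rw [norm_smul, Real.norm_of_nonneg hμ]
        _ ≤ ‖f t‖ + graininess 𝕋 t * (L * ‖f t‖) := by gcongr
        _ ≤ ‖f t‖ * (1 + (L + η) * graininess 𝕋 t) := by
            nlinarith [mul_nonneg (mul_nonneg hη.le hμ) (norm_nonneg (f t))]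
        _ ≤ _ := mul_le_mul h1 h4 (by positivity) (by positivity)
    · intro t ht hat hd hP
      by_cases htb : t ≤ b
      · have h1 := hP htb
        have h2 := hg t ht hat htb
        set k := (‖f a‖ + η) * Real.exp ((L + η) * (t - a)) with hk
        have hkpos : 0 < k := by positivity
        filter_upwards [hf t ht hat (η * k) (by positivity)] with s hs hts _
        rw [hd, abs_sub_comm, abs_of_pos (sub_pos.2 hts)] at hs
        have h3 : s - a = (t - a) + (s - t) := by ring
        rw [h3, mul_add, Real.exp_add, ← mul_assoc, ← hk]
        have h4 : 1 + (L + η) * (s - t) ≤ Real.exp ((L + η) * (s - t)) := by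
          linarith [Real.add_one_le_exp ((L + η) * (s - t))]
        have h5 : ‖(t - s) • g t‖ ≤ (s - t) * (L * k) := by
          rw [norm_smul, Real.norm_eq_abs, abs_sub_comm, abs_of_pos (sub_pos.2 hts)]
          have : L * ‖f t‖ ≤ L * k := by gcongr
          have := sub_pos.2 hts
          gcongr
          linarith
        have e : f s = f t - (t - s) • g t - (f t - f s - (t - s) • g t) := by abel
        calc ‖f s‖ ≤ ‖f t‖ + ‖(t - s) • g t‖ + ‖f t - f s - (t - s) • g t‖ := by
              rw [e]
              exact (norm_sub_le _ _).trans (by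
                rw [← e]; gcongr; exact norm_sub_le _ _)
          _ ≤ k * (1 + (L + η) * (s - t)) := by nlinarith
          _ ≤ _ := by gcongr
      · exact Eventually.of_forall fun s hts hsb => absurd (hts.le.trans hsb) htb
    · intro t ht hat hfr htb
      have hcont := (hf t ht hat.le).continuousWithinAt ht
      have hcont2 : ContinuousWithinAt
          (fun s => (‖f a‖ + η) * Real.exp ((L + η) * (s - a))) 𝕋 t := by fun_prop
      by_contra! hlt
      obtain ⟨s, hs, hs'⟩ := (hfr.and_eventually (hcont2.eventually_lt hcont.norm hlt)).exists
      exact absurd (hs.2 (hs.1.le.trans htb)) (not_le.2 hs')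
  intro t ht hat htb
  have hlim : Tendsto (fun η : ℝ => (‖f a‖ + η) * Real.exp ((L + η) * (t - a))) (𝓝[>] 0)
      (𝓝 (‖f a‖ * Real.exp (L * (t - a)))) := by
    have : Tendsto (fun η : ℝ => (‖f a‖ + η) * Real.exp ((L + η) * (t - a))) (𝓝 0)
        (𝓝 ((‖f a‖ + 0) * Real.exp ((L + 0) * (t - a)))) := by
      apply Continuous.tendsto
      fun_prop
    simp only [add_zero] at this
    exact this.mono_left nhdsWithin_le_nhds
  exact ge_of_tendsto hlim (by
    filter_upwards [self_mem_nhdsWithin] with η hη using key η hη t ht hat htb)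

end DeltaDeriv

/-! ### Rd-continuous functions -/

section RdContinuous

variable {𝕋 : Set ℝ} {E : Type*} [NormedAddCommGroup E] {f : ℝ → E}

/-- Rd-continuity for functions with values in a normed space, stated without the backward jump:
continuity along `𝕋` at right-dense points, and a limit along `𝕋 ∩ (-∞, t)` at every `t ∈ 𝕋`. At a
left-scattered point the latter filter is trivial, so nothing is asked there. -/
structure HasRdLimits (𝕋 : Set ℝ) (f : ℝ → E) : Prop where
  continuousWithinAt : ∀ t ∈ 𝕋, forwardJump 𝕋 t = t → ContinuousWithinAt f 𝕋 t
  exists_tendsto_left : ∀ t ∈ 𝕋, ∃ l : E, Tendsto f (𝓝[𝕋 ∩ Iio t] t) (𝓝 l)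

lemma nhdsWithin_inter_Iio_eq_bot {t : ℝ} (h : backwardJump 𝕋 t ≠ t) :
    𝓝[𝕋 ∩ Iio t] t = ⊥ := by
  by_cases hne : (𝕋 ∩ Iio t).Nonempty
  · rw [backwardJump, if_pos hne] at h
    have hbdd : BddAbove (𝕋 ∩ Iio t) := ⟨t, fun _ hs => le_of_lt hs.2⟩
    have hlt : sSup (𝕋 ∩ Iio t) < t := lt_of_le_of_ne (csSup_le hne fun s hs => le_of_lt hs.2) h
    rw [← empty_mem_iff_bot]
    filter_upwards [self_mem_nhdsWithin, mem_nhdsWithin_of_mem_nhds (Ioi_mem_nhds hlt)] with s hs hs'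
    exact absurd (le_csSup hbdd hs) (not_le.2 hs')
  · rw [not_nonempty_iff_eq_empty.1 hne, nhdsWithin_empty]

lemma RdContinuous.hasRdLimits {f : ℝ → ℝ} (hf : RdContinuous 𝕋 f) : HasRdLimits 𝕋 f where
  continuousWithinAt := hf.rightDense
  exists_tendsto_left t ht := by
    by_cases h : backwardJump 𝕋 t = t
    · exact hf.leftDense t ht h
    · rw [nhdsWithin_inter_Iio_eq_bot h]
      exact ⟨0, tendsto_bot⟩

lemma HasRdLimits.eventually_norm_le (hf : HasRdLimits 𝕋 f) (hub : ¬ BddAbove 𝕋) {t : ℝ}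
    (ht : t ∈ 𝕋) : ∃ C, ∀ᶠ s in 𝓝[𝕋] t, ‖f s‖ ≤ C := by
  rcases (le_forwardJump hub t).eq_or_lt with h | h
  · refine ⟨‖f t‖ + 1, ?_⟩
    filter_upwards [(hf.continuousWithinAt t ht h.symm).norm.eventually
      (gt_mem_nhds (lt_add_one ‖f t‖))] with s hs using hs.le
  · obtain ⟨l, hl⟩ := hf.exists_tendsto_left t ht
    have h1 := eventually_nhdsWithin_iff.1 (hl.norm.eventually (gt_mem_nhds (lt_add_one ‖l‖)))
    refine ⟨max ‖f t‖ (‖l‖ + 1), ?_⟩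
    filter_upwards [self_mem_nhdsWithin, mem_nhdsWithin_of_mem_nhds h1,
      eventually_le_of_lt_forwardJump hub h] with s hs h2 hst
    rcases hst.eq_or_lt with rfl | hst
    · exact le_max_left _ _
    · exact (h2 ⟨hs, hst⟩).le.trans (le_max_right _ _)

lemma HasRdLimits.exists_bound (hf : HasRdLimits 𝕋 f) (hc : IsClosed 𝕋) (hub : ¬ BddAbove 𝕋)
    (a b : ℝ) : ∃ C, 0 ≤ C ∧ ∀ t ∈ 𝕋, a ≤ t → t ≤ b → ‖f t‖ ≤ C := by
  have hK : IsCompact (𝕋 ∩ Icc a b) := isCompact_Icc.inter_left hc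
  obtain ⟨C, hC⟩ : ∃ C, ∀ t ∈ 𝕋 ∩ Icc a b, ‖f t‖ ≤ C := by
    refine hK.induction_on (p := fun S => ∃ C, ∀ t ∈ S, ‖f t‖ ≤ C) ⟨0, by simp⟩ ?_ ?_ ?_
    · rintro s t hst ⟨C, hC⟩
      exact ⟨C, fun u hu => hC u (hst hu)⟩
    · rintro s t ⟨C, hC⟩ ⟨D, hD⟩
      refine ⟨max C D, ?_⟩
      rintro u (hu | hu)
      · exact (hC u hu).trans (le_max_left _ _)
      · exact (hD u hu).trans (le_max_right _ _)
    · intro t ht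
      obtain ⟨C, hC⟩ := hf.eventually_norm_le hub ht.1
      exact ⟨_, nhdsWithin_mono t inter_subset_left hC, C, fun u hu => hu⟩
  exact ⟨max C 0, le_max_right _ _, fun t ht h1 h2 => (hC t ⟨ht, h1, h2⟩).trans (le_max_left _ _)⟩

/-! ### Antiderivatives of rd-continuous functions -/

lemma countable_rightScattered (hub : ¬ BddAbove 𝕋) :
    {t | t ∈ 𝕋 ∧ t < forwardJump 𝕋 t}.Countable := by
  refine (countable_setOfPred_isolated_right_within (s := 𝕋)).mono fun t ht => ?_
  refine ⟨ht.1, empty_mem_iff_bot.1 ?_⟩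
  filter_upwards [self_mem_nhdsWithin, mem_nhdsWithin_of_mem_nhds (Iio_mem_nhds ht.2)] with s hs hs'
  exact absurd (forwardJump_le hub hs.1 hs.2) (not_le.2 hs')

/-- The last point of the time scale that is not after `s`; the value is only meaningful if there
is one. -/
noncomputable def timeScaleFloor (𝕋 : Set ℝ) (s : ℝ) : ℝ := sSup (𝕋 ∩ Iic s)

section Floor

variable {a s : ℝ}

lemma bddAbove_inter_Iic (s : ℝ) : BddAbove (𝕋 ∩ Iic s) := ⟨s, fun _ h => h.2⟩

lemma timeScaleFloor_mem (hc : IsClosed 𝕋) (ha : a ∈ 𝕋) (has : a ≤ s) :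
    timeScaleFloor 𝕋 s ∈ 𝕋 :=
  closure_minimal inter_subset_left hc (csSup_mem_closure ⟨a, ha, has⟩ (bddAbove_inter_Iic s))

lemma le_timeScaleFloor (ha : a ∈ 𝕋) (has : a ≤ s) : a ≤ timeScaleFloor 𝕋 s :=
  le_csSup (bddAbove_inter_Iic s) ⟨ha, has⟩

lemma timeScaleFloor_le (ha : a ∈ 𝕋) (has : a ≤ s) : timeScaleFloor 𝕋 s ≤ s :=
  csSup_le ⟨a, ha, has⟩ fun _ h => h.2

lemma timeScaleFloor_eq (hub : ¬ BddAbove 𝕋) (ha : a ∈ 𝕋) (has : a ≤ s)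
    (hs : s < forwardJump 𝕋 a) : timeScaleFloor 𝕋 s = a := by
  refine le_antisymm (csSup_le ⟨a, ha, has⟩ fun u hu => ?_) (le_timeScaleFloor ha has)
  by_contra! h
  exact absurd ((forwardJump_le hub hu.1 h).trans hu.2) (not_le.2 hs)

lemma monotoneOn_timeScaleFloor (ha : a ∈ 𝕋) : MonotoneOn (timeScaleFloor 𝕋) (Ici a) :=
  fun _ hs _ _ hst => csSup_le_csSup (bddAbove_inter_Iic _) ⟨a, ha, hs⟩
    (inter_subset_inter_right _ (Iic_subset_Iic.2 hst))

end Floor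

/-- An rd-continuous function is continuous along `𝕋` off the countable set of right-scattered
points, hence agrees on `𝕋` with a Borel function. -/
lemma HasRdLimits.measurable_indicator {f : ℝ → ℂ} (hf : HasRdLimits 𝕋 f) (hc : IsClosed 𝕋)
    (hub : ¬ BddAbove 𝕋) : Measurable (𝕋.indicator f) := by
  classical
  set C := {t | t ∈ 𝕋 ∧ t < forwardJump 𝕋 t} with hC
  have hCc : C.Countable := countable_rightScattered hub
  have hm : MeasurableSet (𝕋 \ C) := hc.measurableSet.diff hCc.measurableSet
  have hcont : ContinuousOn f (𝕋 \ C) := fun t ht =>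
    (hf.continuousWithinAt t ht.1 (le_antisymm (not_lt.1 fun h => ht.2 ⟨ht.1, h⟩)
      (le_forwardJump hub t))).mono sdiff_subset
  have h1 : Measurable ((𝕋 \ C).piecewise f 0) :=
    hcont.measurable_piecewise continuousOn_const hm
  refine h1.measurable_of_countable_ne (hCc.mono fun t ht => ?_)
  by_contra h
  refine ht ?_
  by_cases h𝕋 : t ∈ 𝕋
  · rw [piecewise_eq_of_mem _ _ _ (show t ∈ 𝕋 \ C from ⟨h𝕋, h⟩), indicator_of_mem h𝕋]
  · rw [piecewise_eq_of_notMem _ _ _ fun h => h𝕋 h.1, indicator_of_notMem h𝕋]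
    rfl

/-- Every function with rd-limits has an antiderivative: the ordinary integral of its extension
that is constant on the gaps `[t, σ(t))`. -/
theorem HasRdLimits.exists_isDeltaAntideriv {f : ℝ → ℂ} (hf : HasRdLimits 𝕋 f) (hc : IsClosed 𝕋)
    (hub : ¬ BddAbove 𝕋) (hne : 𝕋.Nonempty) : ∃ F : ℝ → ℂ, IsDeltaAntideriv 𝕋 f F := by
  obtain ⟨t₀, ht₀⟩ := hne
  set g : ℝ → ℂ := fun s => 𝕋.indicator f (timeScaleFloor 𝕋 s) with hg
  have hg_apply : ∀ a ∈ 𝕋, ∀ s, a ≤ s → g s = f (timeScaleFloor 𝕋 s) := fun a ha s has =>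
    indicator_of_mem (timeScaleFloor_mem hc ha has) f
  have hint' : ∀ a ∈ 𝕋, ∀ b, a ≤ b → IntervalIntegrable g MeasureTheory.volume a b := by
    intro a ha b hab
    obtain ⟨C, -, hC⟩ := hf.exists_bound hc hub a b
    rw [intervalIntegrable_iff_integrableOn_Ioc_of_le hab]
    have hmeas : AEMeasurable g (MeasureTheory.volume.restrict (Ioc a b)) :=
      (hf.measurable_indicator hc hub).comp_aemeasurable
        (aemeasurable_restrict_of_monotoneOn measurableSet_Ioc
          ((monotoneOn_timeScaleFloor ha).mono fun s hs => hs.1.le))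
    refine MeasureTheory.IntegrableOn.of_bound measure_Ioc_lt_top hmeas.aestronglyMeasurable C ?_
    filter_upwards [MeasureTheory.ae_restrict_mem measurableSet_Ioc] with s hs
    rw [hg_apply a ha s hs.1.le]
    exact hC _ (timeScaleFloor_mem hc ha hs.1.le) (le_timeScaleFloor ha hs.1.le)
      ((timeScaleFloor_le ha hs.1.le).trans hs.2)
  have hint : ∀ a ∈ 𝕋, ∀ b ∈ 𝕋, IntervalIntegrable g MeasureTheory.volume a b := by
    intro a ha b hb
    rcases le_total a b with h | h
    · exact hint' a ha b h
    · exact (hint' b hb a h).symm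
  set F : ℝ → ℂ := fun t => ∫ s in t₀..t, g s with hF
  have hsub : ∀ a ∈ 𝕋, ∀ b ∈ 𝕋, F b - F a = ∫ s in a..b, g s := fun a ha b hb =>
    intervalIntegral.integral_interval_sub_left (hint _ ht₀ _ hb) (hint _ ht₀ _ ha)
  -- the floor of a point between `a, b ∈ 𝕋` lies between `a` and `b` too
  have hbetween : ∀ a ∈ 𝕋, ∀ b ∈ 𝕋, ∀ s ∈ uIoc a b,
      g s = f (timeScaleFloor 𝕋 s) ∧ timeScaleFloor 𝕋 s ∈ 𝕋 ∩ uIcc a b := by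
    intro a ha b hb s hs
    have hmin : min a b ∈ 𝕋 := by rcases min_choice a b with h | h <;> rwa [h]
    have hs1 : min a b ≤ s := hs.1.le
    exact ⟨hg_apply _ hmin s hs1, timeScaleFloor_mem hc hmin hs1, le_timeScaleFloor hmin hs1,
      (timeScaleFloor_le hmin hs1).trans hs.2⟩
  -- local estimates on `f` along `𝕋` therefore carry over to `F`
  have hev : ∀ t, ∀ P : ℝ → Prop, (∀ᶠ s in 𝓝[𝕋] t, P s) →
      ∀ᶠ s in 𝓝[𝕋] t, ∀ u ∈ 𝕋 ∩ uIcc t s, P u := by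
    intro t P hP
    obtain ⟨r, hr, hsub⟩ := Metric.mem_nhdsWithin_iff.1 hP
    filter_upwards [mem_nhdsWithin_of_mem_nhds (Metric.ball_mem_nhds t hr)] with s hs u hu
    refine hsub ⟨?_, hu.1⟩
    rw [Metric.mem_ball, Real.dist_eq] at hs ⊢
    exact (abs_sub_left_of_mem_uIcc hu.2).trans_lt hs
  refine ⟨F, fun t ht => hasDeltaDerivAt_of_cases hub ?_ ?_ ?_⟩
  · obtain ⟨C, hC⟩ := hf.eventually_norm_le hub ht
    have hbound : ∀ᶠ s in 𝓝[𝕋] t, ‖F s - F t‖ ≤ C * |s - t| := by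
      filter_upwards [self_mem_nhdsWithin, hev t _ hC] with s hs hu
      rw [hsub t ht s hs]
      refine intervalIntegral.norm_integral_le_of_norm_le_const fun v hv => ?_
      obtain ⟨h1, h2⟩ := hbetween t ht s hs v hv
      rw [h1]
      exact hu _ h2
    rw [ContinuousWithinAt, tendsto_iff_norm_sub_tendsto_zero]
    refine squeeze_zero' (Eventually.of_forall fun s => norm_nonneg _) hbound ?_
    have : Tendsto (fun s => C * |s - t|) (𝓝 t) (𝓝 (C * |t - t|)) :=
      Continuous.tendsto (by fun_prop) t
    rw [sub_self, abs_zero, mul_zero] at this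
    exact this.mono_left nhdsWithin_le_nhds
  · have hσ := forwardJump_mem hc hub t
    have hle := le_forwardJump hub t
    rw [← sub_eq_iff_eq_add', hsub t ht _ hσ, graininess, ← intervalIntegral.integral_const]
    refine intervalIntegral.integral_congr_Ioo_of_le hle fun s hs => ?_
    rw [hg_apply t ht s hs.1.le, timeScaleFloor_eq hub ht hs.1.le hs.2]
  · intro hd
    rw [hasDerivWithinAt_iff_isLittleO, Asymptotics.isLittleO_iff]
    intro ε hε
    have hcont := Metric.tendsto_nhds.1 (hf.continuousWithinAt t ht hd) ε hε
    filter_upwards [self_mem_nhdsWithin, hev t _ hcont] with s hs hu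
    have e : F s - F t - (s - t) • f t = ∫ v in t..s, (g v - f t) := by
      rw [intervalIntegral.integral_sub (hint t ht s hs) intervalIntegrable_const,
        intervalIntegral.integral_const, hsub t ht s hs]
    rw [e, Real.norm_eq_abs]
    refine intervalIntegral.norm_integral_le_of_norm_le_const fun v hv => ?_
    obtain ⟨h1, h2⟩ := hbetween t ht s hs v hv
    rw [h1, ← dist_eq_norm]
    exact (hu _ h2).le

end RdContinuous

/-! ### The time scale exponential -/

section Exponential

variable {𝕋 : Set ℝ}

lemma tendsto_graininess_left (hub : ¬ BddAbove 𝕋) {t : ℝ} (ht : t ∈ 𝕋) :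
    Tendsto (graininess 𝕋) (𝓝[𝕋 ∩ Iio t] t) (𝓝 0) := by
  have h : Tendsto (fun s => t - s) (𝓝[𝕋 ∩ Iio t] t) (𝓝 0) := by
    have : Tendsto (fun s => t - s) (𝓝 t) (𝓝 (t - t)) := Continuous.tendsto (by fun_prop) t
    rw [sub_self] at this
    exact this.mono_left nhdsWithin_le_nhds
  refine squeeze_zero' (Eventually.of_forall fun s => graininess_nonneg hub s) ?_ h
  filter_upwards [self_mem_nhdsWithin] with s hs
  exact sub_le_sub_right (forwardJump_le hub ht hs.2) s

lemma tendsto_graininess_of_rightDense (hub : ¬ BddAbove 𝕋) {t : ℝ} (ht : t ∈ 𝕋)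
    (hd : forwardJump 𝕋 t = t) : Tendsto (graininess 𝕋) (𝓝[𝕋] t) (𝓝 0) := by
  rw [Metric.tendsto_nhds]
  intro ε hε
  obtain ⟨u, hu, htu, hut⟩ :=
    exists_mem_Ioo_of_forwardJump_lt hub (show forwardJump 𝕋 t < t + ε by rw [hd]; linarith)
  filter_upwards [mem_nhdsWithin_of_mem_nhds (Iio_mem_nhds htu),
    mem_nhdsWithin_of_mem_nhds (Ioi_mem_nhds (sub_lt_self t hε))] with s hsu hst
  rw [Real.dist_eq, sub_zero, abs_of_nonneg (graininess_nonneg hub s), graininess]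
  simp only [mem_Iio, mem_Ioi] at hsu hst
  rcases lt_or_ge s t with h | h
  · linarith [forwardJump_le hub ht h]
  · linarith [forwardJump_le hub hu hsu]

lemma HasRdLimits.graininess (hub : ¬ BddAbove 𝕋) : HasRdLimits 𝕋 (graininess 𝕋) where
  continuousWithinAt t ht hd := by
    have : _root_.graininess 𝕋 t = 0 := by rw [_root_.graininess, hd, sub_self]
    rw [ContinuousWithinAt, this]
    exact tendsto_graininess_of_rightDense hub ht hd
  exists_tendsto_left t ht := ⟨0, tendsto_graininess_left hub ht⟩

lemma HasRdLimits.neg {f : ℝ → ℝ} (hf : HasRdLimits 𝕋 f) : HasRdLimits 𝕋 (fun t => -f t) where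
  continuousWithinAt t ht hd := (hf.continuousWithinAt t ht hd).neg
  exists_tendsto_left t ht := (hf.exists_tendsto_left t ht).imp' _ fun _ h => h.neg

lemma HasRdLimits.add {f g : ℝ → ℝ} (hf : HasRdLimits 𝕋 f) (hg : HasRdLimits 𝕋 g) :
    HasRdLimits 𝕋 (fun t => f t + g t) where
  continuousWithinAt t ht hd := (hf.continuousWithinAt t ht hd).add (hg.continuousWithinAt t ht hd)
  exists_tendsto_left t ht :=
    let ⟨_, h⟩ := hf.exists_tendsto_left t ht
    let ⟨_, h'⟩ := hg.exists_tendsto_left t ht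
    ⟨_, h.add h'⟩

lemma HasRdLimits.mul {f g : ℝ → ℝ} (hf : HasRdLimits 𝕋 f) (hg : HasRdLimits 𝕋 g) :
    HasRdLimits 𝕋 (fun t => f t * g t) where
  continuousWithinAt t ht hd := (hf.continuousWithinAt t ht hd).mul (hg.continuousWithinAt t ht hd)
  exists_tendsto_left t ht :=
    let ⟨_, h⟩ := hf.exists_tendsto_left t ht
    let ⟨_, h'⟩ := hg.exists_tendsto_left t ht
    ⟨_, h.mul h'⟩

/-- The cylinder transformation is jointly continuous at step size `0`. -/
lemma tendsto_cylinderTransform {α : Type*} {l : Filter α} {h : α → ℝ} {r : α → ℂ} {z : ℂ}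
    (hh : Tendsto h l (𝓝 0)) (hr : Tendsto r l (𝓝 z)) :
    Tendsto (fun s => cylinderTransform (h s) (r s)) l (𝓝 z) := by
  have hderiv : HasDerivAt (fun w : ℂ => Complex.log (1 + w)) 1 0 := by
    have := ((hasDerivAt_id (0 : ℂ)).const_add 1).clog (by simp)
    simpa using this
  -- `Log (1 + h z) / h = z * φ (h z)` with `φ w = Log (1 + w) / w`, extended continuously by `1`
  set φ := dslope (fun w : ℂ => Complex.log (1 + w)) 0 with hφ
  have hφc : ContinuousAt φ 0 := continuousAt_dslope_same.2 hderiv.differentiableAt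
  have hφ0 : φ 0 = 1 := by rw [hφ, dslope_same, hderiv.deriv]
  have heq : ∀ (a : ℝ) (w : ℂ), cylinderTransform a w = w * φ (a * w) := by
    intro a w
    unfold cylinderTransform
    split_ifs with ha
    · simp [ha, hφ0]
    · have ha' : (a : ℂ) ≠ 0 := by exact_mod_cast ha
      rcases eq_or_ne w 0 with rfl | hw
      · simp
      · rw [hφ, dslope_of_ne _ (mul_ne_zero ha' hw), slope_def_field]
        simp only [add_zero, Complex.log_one, sub_zero]
        field_simp
  have hprod : Tendsto (fun s => (h s : ℂ) * r s) l (𝓝 0) := by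
    have := ((Complex.continuous_ofReal.tendsto 0).comp hh).mul hr
    simpa using this
  have := hr.mul (hφc.tendsto.comp hprod)
  rw [hφ0, mul_one] at this
  exact this.congr fun s => (heq _ _).symm

lemma HasRdLimits.cylinderTransform {r : ℝ → ℝ} (hr : HasRdLimits 𝕋 r) (hub : ¬ BddAbove 𝕋) :
    HasRdLimits 𝕋 (fun τ => cylinderTransform (_root_.graininess 𝕋 τ) (r τ)) where
  continuousWithinAt t ht hd := by
    have h0 : _root_.graininess 𝕋 t = 0 := by rw [_root_.graininess, hd, sub_self]
    have h1 : _root_.cylinderTransform (_root_.graininess 𝕋 t) (r t) = r t := by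
      rw [_root_.cylinderTransform, if_pos h0]
    rw [ContinuousWithinAt, h1]
    exact tendsto_cylinderTransform (tendsto_graininess_of_rightDense hub ht hd)
      ((Complex.continuous_ofReal.tendsto _).comp (hr.continuousWithinAt t ht hd))
  exists_tendsto_left t ht := by
    obtain ⟨l, hl⟩ := hr.exists_tendsto_left t ht
    exact ⟨l, tendsto_cylinderTransform (tendsto_graininess_left hub ht)
      ((Complex.continuous_ofReal.tendsto _).comp hl)⟩

lemma exp_mul_cylinderTransform {h : ℝ} {z : ℂ} (hz : 1 + h * z ≠ 0) :
    Complex.exp (h * cylinderTransform h z) = 1 + h * z := by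
  unfold cylinderTransform
  split_ifs with h0
  · simp [h0]
  · rw [mul_div_cancel₀ _ (by exact_mod_cast h0), Complex.exp_log hz]

/-- The solutions of `w^Δ = r w` are the multiples of the time scale exponential: if `F` is an
antiderivative of the cylinder transform of `r`, then `exp (-F) w` has delta derivative `0`. -/
theorem eq_timeScaleExp_mul (hc : IsClosed 𝕋) (hub : ¬ BddAbove 𝕋) {r w : ℝ → ℝ}
    (hr : HasRdLimits 𝕋 r) (hreg : ∀ t ∈ 𝕋, 1 + graininess 𝕋 t * r t ≠ 0)
    (hw : ∀ t ∈ 𝕋, HasDeltaDerivAt 𝕋 w (r t * w t) t) {s t : ℝ} (hs : s ∈ 𝕋) (ht : t ∈ 𝕋)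
    (hst : s ≤ t) : (w t : ℂ) = timeScaleExp 𝕋 r t s * w s := by
  have hex := (hr.cylinderTransform hub).exists_isDeltaAntideriv hc hub ⟨s, hs⟩
  rw [timeScaleExp, deltaIntegral, dif_pos hex]
  set F := hex.choose
  have hF : IsDeltaAntideriv 𝕋 _ F := hex.choose_spec
  set G : ℝ → ℂ := fun u => Complex.exp (-F u) * w u with hG
  have hGd : ∀ u ∈ 𝕋, HasDeltaDerivAt 𝕋 G 0 u := by
    intro u hu
    refine hasDeltaDerivAt_of_cases hub ?_ ?_ fun hd => ?_
    · have h1 := (hF u hu).continuousWithinAt hu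
      have h2 := (hw u hu).continuousWithinAt hu
      exact h1.neg.cexp.mul (Complex.continuous_ofReal.continuousAt.comp_continuousWithinAt h2)
    · have hz : 1 + (graininess 𝕋 u : ℂ) * (r u : ℂ) ≠ 0 := by exact_mod_cast hreg u hu
      rw [smul_zero, add_zero, hG]
      simp only
      rw [(hF u hu).apply_forwardJump hu, (hw u hu).apply_forwardJump hu, neg_add, Complex.exp_add,
        Complex.real_smul, Complex.exp_neg (_ * _), exp_mul_cylinderTransform hz, smul_eq_mul]
      have e : ((w u + graininess 𝕋 u * (r u * w u) : ℝ) : ℂ) =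
          (1 + (graininess 𝕋 u : ℂ) * (r u : ℂ)) * w u := by push_cast; ring
      rw [e, mul_assoc, inv_mul_cancel_left₀ hz]
    · have h0 : graininess 𝕋 u = 0 := by rw [graininess, hd, sub_self]
      have h1 := (hasDeltaDerivAt_iff_of_rightDense hd).1 (hF u hu)
      have h2 := ((hasDeltaDerivAt_iff_of_rightDense hd).1 (hw u hu)).ofReal_comp
      have h3 := h1.neg.cexp.mul h2
      refine h3.congr_deriv ?_
      simp only [cylinderTransform, if_pos h0]
      push_cast
      ring
  have hconst : G t = G s := by
    rw [← sub_eq_zero, ← norm_le_zero_iff]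
    have hd : ∀ u ∈ 𝕋, s ≤ u → HasDeltaDerivAt 𝕋 (fun v => G v + -G s) 0 u := by
      intro u hu _ ε hε
      filter_upwards [hGd u hu ε hε] with v hv
      rwa [add_sub_add_right_eq_sub]
    have := norm_le_mul_exp_of_norm_deltaDeriv_le hc hub (b := t) (g := fun _ => 0) hs le_rfl hd
      (by simp) t ht hst le_rfl
    simpa [← sub_eq_add_neg] using this
  have h1 : (w t : ℂ) = Complex.exp (F t) * G t := by
    rw [hG]; simp only
    rw [← mul_assoc, ← Complex.exp_add, add_neg_cancel, Complex.exp_zero, one_mul]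
  rw [h1, hconst, hG]
  simp only
  rw [← mul_assoc, ← Complex.exp_add, ← sub_eq_add_neg]

end Exponential

/-! ### Solutions of the second order equation -/

section Solutions

variable {𝕋 : Set ℝ} {p q : ℝ → ℝ}

lemma IsSolution.restrict_Ici {x y : ℝ → ℝ} (h : IsSolution 𝕋 p q x y) (hub : ¬ BddAbove 𝕋)
    (s : ℝ) : IsSolution (𝕋 ∩ Ici s) p q x y where
  deriv_fst t ht := (h.deriv_fst t ht.1).restrict_Ici hub ht.2
  deriv_snd t ht := (h.deriv_snd t ht.1).restrict_Ici hub ht.2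

lemma IsSolution.linearCombination {x y x' y' : ℝ → ℝ} (h : IsSolution 𝕋 p q x y)
    (h' : IsSolution 𝕋 p q x' y') (α β : ℝ) :
    IsSolution 𝕋 p q (fun t => α * x t + β * x' t) (fun t => α * y t + β * y' t) where
  deriv_fst t ht := ((h.deriv_fst t ht).const_smul α).add ((h'.deriv_fst t ht).const_smul β)
  deriv_snd t ht := by
    have := ((h.deriv_snd t ht).const_smul α).add ((h'.deriv_snd t ht).const_smul β)
    convert! this using 1
    simp only [smul_eq_mul]
    ring

/-- Solutions grow at most exponentially, with a constant that only depends on the interval. -/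
theorem exists_bound_of_isSolution (hc : IsClosed 𝕋) (hub : ¬ BddAbove 𝕋)
    (hp : HasRdLimits 𝕋 p) (hq : HasRdLimits 𝕋 q) {s : ℝ} (hs : s ∈ 𝕋) (b : ℝ) :
    ∃ C, 0 < C ∧ ∀ x y, IsSolution (𝕋 ∩ Ici s) p q x y → ∀ t ∈ 𝕋, s ≤ t → t ≤ b →
      max |x t| |y t| ≤ C * max |x s| |y s| := by
  obtain ⟨P, hP0, hP⟩ := hp.exists_bound hc hub s b
  obtain ⟨Q, hQ0, hQ⟩ := hq.exists_bound hc hub s b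
  refine ⟨Real.exp ((1 + P + Q) * (b - s)), Real.exp_pos _, fun x y h t ht hst htb => ?_⟩
  have key := norm_le_mul_exp_of_norm_deltaDeriv_le (𝕋 := 𝕋 ∩ Ici s) (b := b)
    (f := fun t => (x t, y t)) (g := fun t => (y t, -q t * x t - p t * y t)) (L := 1 + P + Q)
    (hc.inter isClosed_Ici) (not_bddAbove_inter_Ici hub s) ⟨hs, self_mem_Ici⟩ (by positivity)
    (fun t ht _ => (h.deriv_fst t ht).prodMk (h.deriv_snd t ht)) ?_ t ⟨ht, hst⟩ hst htb
  · simp only [Prod.norm_mk, Real.norm_eq_abs] at key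
    rw [mul_comm] at key
    refine key.trans ?_
    gcongr
  · intro u hu hsu hub'
    have h1 := hP u hu.1 hsu hub'
    have h2 := hQ u hu.1 hsu hub'
    simp only [Prod.norm_mk, Real.norm_eq_abs] at h1 h2 ⊢
    have hx := le_max_left |x u| |y u|
    have hy := le_max_right |x u| |y u|
    set m := max |x u| |y u|
    have hm : 0 ≤ m := (abs_nonneg _).trans hx
    refine max_le ?_ ?_
    · nlinarith [mul_nonneg hP0 hm, mul_nonneg hQ0 hm]
    · have h3 : |-q u * x u - p u * y u| ≤ |q u| * |x u| + |p u| * |y u| := by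
        rw [← abs_mul, ← abs_mul, ← abs_neg (q u * x u), ← neg_mul]
        exact abs_sub _ _
      have h4 : |q u| * |x u| ≤ Q * m := by gcongr
      have h5 : |p u| * |y u| ≤ P * m := by gcongr
      linarith

/-- Solutions are determined forward in time by their initial values. -/
theorem IsSolution.eq_zero (hc : IsClosed 𝕋) (hub : ¬ BddAbove 𝕋) (hp : HasRdLimits 𝕋 p)
    (hq : HasRdLimits 𝕋 q) {s : ℝ} (hs : s ∈ 𝕋) {x y : ℝ → ℝ}
    (h : IsSolution (𝕋 ∩ Ici s) p q x y) (hx : x s = 0) (hy : y s = 0) {t : ℝ} (ht : t ∈ 𝕋)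
    (hst : s ≤ t) : x t = 0 ∧ y t = 0 := by
  obtain ⟨C, -, hC⟩ := exists_bound_of_isSolution hc hub hp hq hs t
  have := hC x y h t ht hst le_rfl
  rw [hx, hy, abs_zero, max_self, mul_zero, max_le_iff] at this
  exact ⟨abs_nonpos_iff.1 this.1, abs_nonpos_iff.1 this.2⟩

/-- The Wronskian satisfies Liouville's equation `W^Δ = (-p + μ q) W`. -/
lemma IsSolution.hasDeltaDerivAt_wronskian (hub : ¬ BddAbove 𝕋) {x y x' y' : ℝ → ℝ}
    (h : IsSolution 𝕋 p q x y) (h' : IsSolution 𝕋 p q x' y') {t : ℝ} (ht : t ∈ 𝕋) :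
    HasDeltaDerivAt 𝕋 (fun t => x t * y' t - x' t * y t)
      ((-p t + graininess 𝕋 t * q t) * (x t * y' t - x' t * y t)) t := by
  have hx := h.deriv_fst t ht
  have hy := h.deriv_snd t ht
  have hx' := h'.deriv_fst t ht
  have hy' := h'.deriv_snd t ht
  refine hasDeltaDerivAt_of_cases hub ?_ ?_ fun hd => ?_
  · exact ((hx.continuousWithinAt ht).mul (hy'.continuousWithinAt ht)).sub
      ((hx'.continuousWithinAt ht).mul (hy.continuousWithinAt ht))
  · simp only [hx.apply_forwardJump ht, hy.apply_forwardJump ht, hx'.apply_forwardJump ht,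
      hy'.apply_forwardJump ht, smul_eq_mul]
    ring
  · have h0 : graininess 𝕋 t = 0 := by rw [graininess, hd, sub_self]
    rw [hasDeltaDerivAt_iff_of_rightDense hd] at hx hy hx' hy'
    refine ((hx.mul hy').sub (hx'.mul hy)).congr_deriv ?_
    rw [h0]
    ring

/-! ### Periodicity -/

/-- Translation by `c` maps `𝕋` into itself and leaves the graininess and the coefficients of the
equation invariant. -/
structure IsEquationPeriod (𝕋 : Set ℝ) (p q : ℝ → ℝ) (c : ℝ) : Prop where
  add_mem : ∀ t ∈ 𝕋, t + c ∈ 𝕋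
  graininess_add : ∀ t ∈ 𝕋, graininess 𝕋 (t + c) = graininess 𝕋 t
  fst_add : ∀ t ∈ 𝕋, p (t + c) = p t
  snd_add : ∀ t ∈ 𝕋, q (t + c) = q t

lemma IsEquationPeriod.nat_mul {T : ℝ} (h : IsEquationPeriod 𝕋 p q T) (n : ℕ) :
    IsEquationPeriod 𝕋 p q (n * T) := by
  induction n with
  | zero => constructor <;> simp
  | succ n ih =>
    have e : ∀ t, t + (n + 1 : ℕ) * T = (t + n * T) + T := fun t => by push_cast; ring
    constructor <;> intro t ht <;> rw [e]
    · exact h.add_mem _ (ih.add_mem t ht)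
    · rw [h.graininess_add _ (ih.add_mem t ht), ih.graininess_add t ht]
    · rw [h.fst_add _ (ih.add_mem t ht), ih.fst_add t ht]
    · rw [h.snd_add _ (ih.add_mem t ht), ih.snd_add t ht]

lemma IsEquationPeriod.hasDeltaDerivAt_comp_add {c : ℝ} (h : IsEquationPeriod 𝕋 p q c)
    (hub : ¬ BddAbove 𝕋) {s s' : ℝ} (hss : s ≤ s' + c) {f : ℝ → ℝ} {f' t : ℝ}
    (ht : t ∈ 𝕋) (hst : s' ≤ t) (hf : HasDeltaDerivAt (𝕋 ∩ Ici s) f f' (t + c)) :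
    HasDeltaDerivAt (𝕋 ∩ Ici s') (fun u => f (u + c)) f' t := by
  intro ε hε
  have hj : forwardJump (𝕋 ∩ Ici s) (t + c) = forwardJump (𝕋 ∩ Ici s') t + c := by
    rw [forwardJump_inter_Ici hub (by linarith), forwardJump_inter_Ici hub hst]
    have := h.graininess_add t ht
    unfold graininess at this
    linarith
  have hmap : Tendsto (fun u => u + c) (𝓝[𝕋 ∩ Ici s'] t) (𝓝[𝕋 ∩ Ici s] (t + c)) :=
    tendsto_nhdsWithin_of_tendsto_nhds_of_eventually_within _
      ((Continuous.tendsto (by fun_prop) t).mono_left nhdsWithin_le_nhds)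
      (by
        filter_upwards [self_mem_nhdsWithin] with u hu
        exact ⟨h.add_mem u hu.1, hss.trans (by gcongr; exact hu.2)⟩)
  filter_upwards [hmap.eventually (hf ε hε)] with u hu
  rw [hj] at hu
  simpa only [add_sub_add_right_eq_sub] using hu

lemma IsSolution.comp_add {c : ℝ} (hper : IsEquationPeriod 𝕋 p q c) (hub : ¬ BddAbove 𝕋)
    {s s' : ℝ} (hss : s ≤ s' + c) {x y : ℝ → ℝ} (h : IsSolution (𝕋 ∩ Ici s) p q x y) :
    IsSolution (𝕋 ∩ Ici s') p q (fun t => x (t + c)) (fun t => y (t + c)) where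
  deriv_fst t ht := hper.hasDeltaDerivAt_comp_add hub hss ht.1 ht.2
    (h.deriv_fst _ ⟨hper.add_mem t ht.1, hss.trans (by gcongr; exact ht.2)⟩)
  deriv_snd t ht := by
    have := hper.hasDeltaDerivAt_comp_add hub hss ht.1 ht.2
      (h.deriv_snd _ ⟨hper.add_mem t ht.1, hss.trans (by gcongr; exact ht.2)⟩)
    rwa [hper.fst_add t ht.1, hper.snd_add t ht.1] at this

lemma IsPeriodicTimeScale.not_bddAbove {T : ℝ} (hT : IsPeriodicTimeScale 𝕋 T)
    (hne : 𝕋.Nonempty) : ¬ BddAbove 𝕋 := by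
  intro hb
  obtain ⟨t, ht, hlt⟩ := exists_lt_of_lt_csSup hne (sub_lt_self (sSup 𝕋) hT.pos)
  exact absurd (le_csSup hb (hT.add_mem t ht)) (not_le.2 (by linarith))

/-- Periodicity of the graininess makes the time scale invariant under backward translation too,
as long as one stays to the right of one of its points: a missing translate would lie in a gap
which the forward translation reproduces. -/
lemma IsPeriodicTimeScale.sub_mem {T : ℝ} (hT : IsPeriodicTimeScale 𝕋 T) (hc : IsClosed 𝕋)
    {a t : ℝ} (ha : a ∈ 𝕋) (ht : t ∈ 𝕋) (hat : a ≤ t - T) : t - T ∈ 𝕋 := by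
  have hub := hT.not_bddAbove ⟨a, ha⟩
  have hr := timeScaleFloor_mem hc ha hat
  have hle := timeScaleFloor_le ha hat
  set r := timeScaleFloor 𝕋 (t - T) with hrdef
  rcases hle.eq_or_lt with h | h
  · rwa [← h]
  · have h1 : t - T < forwardJump 𝕋 r := by
      by_contra! hj
      have := le_timeScaleFloor (forwardJump_mem hc hub r) hj
      have heq : forwardJump 𝕋 r = r := le_antisymm this (le_forwardJump hub r)
      obtain ⟨u, hu, hru, hut⟩ := exists_mem_Ioo_of_forwardJump_lt hub (heq.trans_lt h)
      exact absurd (le_timeScaleFloor hu hut.le) (not_le.2 hru)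
    have h2 : forwardJump 𝕋 (r + T) ≤ t := forwardJump_le hub ht (by linarith)
    have h3 := hT.graininess_add r hr
    unfold graininess at h3
    linarith

lemma IsPeriodicTimeScale.exists_eq_add_nat_mul {T : ℝ} (hT : IsPeriodicTimeScale 𝕋 T)
    (hc : IsClosed 𝕋) {a t : ℝ} (ha : a ∈ 𝕋) (ht : t ∈ 𝕋) (hat : a ≤ t) :
    ∃ u ∈ 𝕋, a ≤ u ∧ u ≤ a + T ∧ ∃ n : ℕ, t = u + n * T := by
  have key : ∀ n : ℕ, ∀ t ∈ 𝕋, a ≤ t → t ≤ a + (n + 1) * T →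
      ∃ u ∈ 𝕋, a ≤ u ∧ u ≤ a + T ∧ ∃ n : ℕ, t = u + n * T := by
    intro n
    induction n with
    | zero => exact fun t ht h1 h2 => ⟨t, ht, h1, by simpa using h2, 0, by simp⟩
    | succ n ih =>
      intro t ht h1 h2
      rcases le_total t (a + T) with h | h
      · exact ⟨t, ht, h1, h, 0, by simp⟩
      · have h3 : a ≤ t - T := by linarith
        push_cast at h2
        obtain ⟨u, hu, hu1, hu2, m, hm⟩ := ih (t - T) (hT.sub_mem hc ha ht h3) h3 (by linarith)
        exact ⟨u, hu, hu1, hu2, m + 1, by push_cast; linarith⟩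
  obtain ⟨n, hn⟩ := exists_nat_ge ((t - a) / T)
  refine key n t ht hat ?_
  rw [div_le_iff₀ hT.pos] at hn
  linarith [hT.pos]

/-! ### The monodromy recurrence -/

/-- The solutions `(x₁, y₁)` and `(x₂, y₂)` with the unit vectors as initial values at `t₀`. -/
structure IsFundamentalSystem (𝕋 : Set ℝ) (p q : ℝ → ℝ) (t₀ : ℝ) (x₁ y₁ x₂ y₂ : ℝ → ℝ) :
    Prop where
  isSolution₁ : IsSolution 𝕋 p q x₁ y₁
  isSolution₂ : IsSolution 𝕋 p q x₂ y₂
  x₁_init : x₁ t₀ = 1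
  y₁_init : y₁ t₀ = 0
  x₂_init : x₂ t₀ = 0
  y₂_init : y₂ t₀ = 1

variable {t₀ T : ℝ} {x₁ y₁ x₂ y₂ : ℝ → ℝ}

lemma IsFundamentalSystem.eq_linearCombination (hc : IsClosed 𝕋) (hub : ¬ BddAbove 𝕋)
    (hp : HasRdLimits 𝕋 p) (hq : HasRdLimits 𝕋 q)
    (hΦ : IsFundamentalSystem 𝕋 p q t₀ x₁ y₁ x₂ y₂) (ht₀ : t₀ ∈ 𝕋) {x y : ℝ → ℝ}
    (h : IsSolution (𝕋 ∩ Ici t₀) p q x y) {t : ℝ} (ht : t ∈ 𝕋) (htt : t₀ ≤ t) :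
    x t = x t₀ * x₁ t + y t₀ * x₂ t ∧ y t = x t₀ * y₁ t + y t₀ * y₂ t := by
  have h1 := (hΦ.isSolution₁.restrict_Ici hub t₀).linearCombination
    (hΦ.isSolution₂.restrict_Ici hub t₀) (x t₀) (y t₀)
  have h2 := (h.linearCombination h1 1 (-1)).eq_zero hc hub hp hq ht₀
    (by rw [hΦ.x₁_init, hΦ.x₂_init]; ring) (by rw [hΦ.y₁_init, hΦ.y₂_init]; ring) ht htt
  constructor <;> linarith [h2.1, h2.2]

/-- By the Cayley–Hamilton theorem for the monodromy matrix, the values of a solution at points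
one period apart satisfy a linear recurrence whose coefficients are the trace and the determinant
of that matrix. -/
theorem IsFundamentalSystem.recurrence (hc : IsClosed 𝕋) (hub : ¬ BddAbove 𝕋)
    (hp : HasRdLimits 𝕋 p) (hq : HasRdLimits 𝕋 q)
    (hΦ : IsFundamentalSystem 𝕋 p q t₀ x₁ y₁ x₂ y₂) (ht₀ : t₀ ∈ 𝕋) (hT : 0 ≤ T)
    (hper : IsEquationPeriod 𝕋 p q T) {s : ℝ} (k : ℕ) (hk : s ≤ t₀ + k * T) {x y : ℝ → ℝ}
    (h : IsSolution (𝕋 ∩ Ici s) p q x y) {t : ℝ} (ht : t ∈ 𝕋) (htk : t₀ + k * T ≤ t) :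
    (x (t + T + T) = (x₁ (t₀ + T) + y₂ (t₀ + T)) * x (t + T) -
      (x₁ (t₀ + T) * y₂ (t₀ + T) - x₂ (t₀ + T) * y₁ (t₀ + T)) * x t) ∧
    y (t + T + T) = (x₁ (t₀ + T) + y₂ (t₀ + T)) * y (t + T) -
      (x₁ (t₀ + T) * y₂ (t₀ + T) - x₂ (t₀ + T) * y₁ (t₀ + T)) * y t := by
  set A := x₁ (t₀ + T) + y₂ (t₀ + T) with hA
  set B := x₁ (t₀ + T) * y₂ (t₀ + T) - x₂ (t₀ + T) * y₁ (t₀ + T) with hB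
  set r := t₀ + k * T with hr
  have hr𝕋 : r ∈ 𝕋 := (hper.nat_mul k).add_mem t₀ ht₀
  have hcomb := fun {x y : ℝ → ℝ} (h : IsSolution (𝕋 ∩ Ici t₀) p q x y) =>
    hΦ.eq_linearCombination hc hub hp hq ht₀ h (hper.add_mem t₀ ht₀) (by linarith)
  have hv := h.comp_add (hper.nat_mul k) hub hk
  have hv' := hv.comp_add hper hub (s' := t₀) (by linarith)
  obtain ⟨e1, e2⟩ := hcomb hv
  obtain ⟨e3, e4⟩ := hcomb hv'
  have c1 : t₀ + T + k * T = r + T := by rw [hr]; ring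
  have c2 : t₀ + T + T + k * T = r + T + T := by rw [hr]; ring
  simp only [c1, c2, ← hr] at e1 e2 e3 e4
  have hres := h.comp_add (s' := r) (c := 0) (by constructor <;> simp) hub (by simpa using hk)
  simp only [add_zero] at hres
  have hres1 := hres.comp_add hper hub (s' := r) (by linarith)
  have hres2 := hres1.comp_add hper hub (s' := r) (by linarith)
  have hu := (hres2.linearCombination (hres1.linearCombination hres (-A) B) 1 1).eq_zero hc hub hp hq
    hr𝕋 (by simp only [e1, e2, e3, hA, hB]; ring) (by simp only [e1, e2, e4, hA, hB]; ring)
    ht htk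
  constructor <;> linarith [hu.1, hu.2]

end Solutions

/-! ### Second order linear recurrences -/

section Recurrence

variable {ρ₁ ρ₂ : ℂ} {a : ℕ → ℂ}

/-- One of the two first order factors of the recurrence with characteristic roots `ρ₁, ρ₂`. -/
lemma eq_pow_mul_of_recurrence (h : ∀ n, a (n + 2) = (ρ₁ + ρ₂) * a (n + 1) - ρ₁ * ρ₂ * a n)
    (n : ℕ) : a (n + 1) - ρ₂ * a n = ρ₁ ^ n * (a 1 - ρ₂ * a 0) := by
  induction n with
  | zero => simp
  | succ n ih =>
    rw [pow_succ', mul_assoc, ← ih, h]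
    ring

lemma norm_le_of_recurrence (h₁ : ‖ρ₁‖ < 1) (h₂ : ‖ρ₂‖ < 1)
    (h : ∀ n, a (n + 2) = (ρ₁ + ρ₂) * a (n + 1) - ρ₁ * ρ₂ * a n) (n : ℕ) :
    ‖a n‖ ≤ (‖a 0‖ + ‖a 1‖) / (1 - ‖ρ₂‖) := by
  have hpos : 0 < 1 - ‖ρ₂‖ := by linarith
  set S := ‖a 0‖ + ‖a 1‖ with hS
  have hS0 : 0 ≤ S := by positivity
  have hw : ∀ n, ‖a (n + 1) - ρ₂ * a n‖ ≤ S := by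
    intro n
    rw [eq_pow_mul_of_recurrence h, norm_mul, norm_pow]
    calc ‖ρ₁‖ ^ n * ‖a 1 - ρ₂ * a 0‖ ≤ 1 * (‖a 1‖ + 1 * ‖a 0‖) := by
          gcongr
          · exact pow_le_one₀ (norm_nonneg _) h₁.le
          · refine (norm_sub_le _ _).trans ?_
            rw [norm_mul]
            gcongr
      _ = S := by rw [hS]; ring
  induction n with
  | zero =>
    rw [le_div_iff₀ hpos]
    nlinarith [norm_nonneg (a 0), norm_nonneg (a 1), norm_nonneg ρ₂]
  | succ n ih =>
    have e : a (n + 1) = ρ₂ * a n + (a (n + 1) - ρ₂ * a n) := by ring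
    rw [e]
    refine (norm_add_le _ _).trans ?_
    rw [norm_mul]
    calc ‖ρ₂‖ * ‖a n‖ + ‖a (n + 1) - ρ₂ * a n‖ ≤ ‖ρ₂‖ * (S / (1 - ‖ρ₂‖)) + S := by
          gcongr
          exact hw n
      _ = S / (1 - ‖ρ₂‖) := by field_simp; ring

lemma eq_zero_of_eventually_norm_pow_mul_le {ρ c : ℂ} (hρ : 1 < ‖ρ‖) {K : ℝ}
    (hK : ∀ᶠ n in atTop, ‖ρ ^ n * c‖ ≤ K) : c = 0 := by
  by_contra hc
  have ht : Tendsto (fun n => ‖ρ ^ n * c‖) atTop atTop := by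
    simp only [norm_mul, norm_pow]
    exact (tendsto_pow_atTop_atTop_of_one_lt hρ).atTop_mul_const (norm_pos_iff.2 hc)
  obtain ⟨n, h1, h2⟩ := (hK.and (ht.eventually (eventually_gt_atTop K))).exists
  linarith

/-- A bounded solution of the recurrence has no component along a root outside the unit disc. -/
lemma eq_mul_of_recurrence_of_bounded (h₁ : 1 < ‖ρ₁‖)
    (h : ∀ n, a (n + 2) = (ρ₁ + ρ₂) * a (n + 1) - ρ₁ * ρ₂ * a n) {K : ℝ}
    (hK : ∀ᶠ n in atTop, ‖a n‖ ≤ K) (n : ℕ) : a (n + 1) = ρ₂ * a n := by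
  have h0 : a 1 - ρ₂ * a 0 = 0 := by
    refine eq_zero_of_eventually_norm_pow_mul_le h₁ (K := K + ‖ρ₂‖ * K) ?_
    filter_upwards [hK, (tendsto_add_atTop_nat 1).eventually hK] with n hn hn'
    rw [← eq_pow_mul_of_recurrence h]
    refine (norm_sub_le _ _).trans ?_
    rw [norm_mul]
    gcongr
  rw [← sub_eq_zero, eq_pow_mul_of_recurrence h, h0, mul_zero]

end Recurrence

/-! ### Stability and instability -/

section Stability

variable {𝕋 : Set ℝ} {p q : ℝ → ℝ} {t₀ T : ℝ} {x₁ y₁ x₂ y₂ : ℝ → ℝ} {ρ₁ ρ₂ : ℂ}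

theorem isStableFrom_of_norm_lt_one (hc : IsClosed 𝕋) (hT : IsPeriodicTimeScale 𝕋 T)
    (hp : HasRdLimits 𝕋 p) (hq : HasRdLimits 𝕋 q)
    (hΦ : IsFundamentalSystem 𝕋 p q t₀ x₁ y₁ x₂ y₂) (ht₀ : t₀ ∈ 𝕋)
    (hper : IsEquationPeriod 𝕋 p q T)
    (hsum : ((x₁ (t₀ + T) + y₂ (t₀ + T) : ℝ) : ℂ) = ρ₁ + ρ₂)
    (hprod : ((x₁ (t₀ + T) * y₂ (t₀ + T) - x₂ (t₀ + T) * y₁ (t₀ + T) : ℝ) : ℂ) = ρ₁ * ρ₂)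
    (h₁ : ‖ρ₁‖ < 1) (h₂ : ‖ρ₂‖ < 1) {s : ℝ} (hs : s ∈ 𝕋) : IsStableFrom 𝕋 p q s := by
  have hub := hT.not_bddAbove ⟨s, hs⟩
  obtain ⟨k, hk⟩ : ∃ k : ℕ, s ≤ t₀ + k * T := by
    obtain ⟨k, hk⟩ := exists_nat_ge ((s - t₀) / T)
    rw [div_le_iff₀ hT.pos] at hk
    exact ⟨k, by linarith⟩
  set r := t₀ + k * T with hr
  have hr𝕋 : r ∈ 𝕋 := (hper.nat_mul k).add_mem t₀ ht₀
  obtain ⟨C, hC0, hC⟩ := exists_bound_of_isSolution hc hub hp hq hs (r + T + T)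
  have hpos : 0 < 1 - ‖ρ₂‖ := by linarith
  set D := C + (C + C) / (1 - ‖ρ₂‖) with hD
  have hD0 : 0 < D := by positivity
  have hTpos := hT.pos
  -- Grönwall's inequality covers `[s, r + 2T]`, the recurrence everything to the right of `r`
  have key : ∀ x y, IsSolution (𝕋 ∩ Ici s) p q x y → ∀ t ∈ 𝕋, s ≤ t →
      max |x t| |y t| ≤ D * max |x s| |y s| := by
    intro x y h t ht hst
    set m := max |x s| |y s|
    have hm : 0 ≤ m := (abs_nonneg _).trans (le_max_left _ _)
    have hCD : C * m ≤ D * m := by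
      rw [hD]; gcongr; exact le_add_of_nonneg_right (by positivity)
    rcases le_total t r with htr | htr
    · exact (hC x y h t ht hst (by linarith)).trans hCD
    · obtain ⟨u, hu, hru, hur, n, rfl⟩ := hT.exists_eq_add_nat_mul hc hr𝕋 ht htr
      have hrec : ∀ n : ℕ, _ := fun n => hΦ.recurrence hc hub hp hq ht₀ hT.pos.le hper k hk h
        ((hper.nat_mul n).add_mem u hu) (hru.trans (le_add_of_nonneg_right (by positivity)))
      have c1 : ∀ n : ℕ, u + n * T + T = u + (n + 1 : ℕ) * T := fun n => by push_cast; ring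
      simp only [c1] at hrec
      have hb0 := hC x y h u hu (hk.trans hru) (by linarith)
      have hb1 := hC x y h (u + T) (hper.add_mem u hu) (by linarith) (by linarith)
      have hz : ∀ z : ℝ → ℝ, |z u| ≤ C * m → |z (u + T)| ≤ C * m →
          (∀ n : ℕ, z (u + (n + 1 + 1 : ℕ) * T) = (x₁ (t₀ + T) + y₂ (t₀ + T)) *
            z (u + (n + 1 : ℕ) * T) - (x₁ (t₀ + T) * y₂ (t₀ + T) - x₂ (t₀ + T) * y₁ (t₀ + T)) *
            z (u + n * T)) → |z (u + n * T)| ≤ D * m := by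
        intro z h0 h1 hz
        have := norm_le_of_recurrence (a := fun n : ℕ => (z (u + n * T) : ℂ)) h₁ h₂ (fun n => by
          rw [← hsum, ← hprod, ← Complex.ofReal_mul, ← Complex.ofReal_mul, ← Complex.ofReal_sub]
          exact congrArg _ (hz n)) n
        simp only [Complex.norm_real, Real.norm_eq_abs, Nat.cast_zero, zero_mul, add_zero,
          Nat.cast_one, one_mul] at this
        calc |z (u + n * T)| ≤ (C * m + C * m) / (1 - ‖ρ₂‖) := this.trans (by gcongr)
          _ ≤ D * m := by
            rw [hD, add_mul, ← add_mul, div_mul_eq_mul_div]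
            exact le_add_of_nonneg_left (by positivity)
      exact max_le
        (hz x ((le_max_left _ _).trans hb0) ((le_max_left _ _).trans hb1) fun n => (hrec n).1)
        (hz y ((le_max_right _ _).trans hb0) ((le_max_right _ _).trans hb1) fun n => (hrec n).2)
  intro ε hε
  refine ⟨ε / D, by positivity, fun x y h hx hy t ht hst => ?_⟩
  have h1 : max |x s| |y s| < ε / D := max_lt hx hy
  rw [lt_div_iff₀ hD0, mul_comm] at h1
  exact max_lt_iff.1 ((key x y h t ht hst).trans_lt h1)

theorem not_isStableFrom_of_one_lt_norm (hc : IsClosed 𝕋) (hT : IsPeriodicTimeScale 𝕋 T)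
    (hp : HasRdLimits 𝕋 p) (hq : HasRdLimits 𝕋 q)
    (hΦ : IsFundamentalSystem 𝕋 p q t₀ x₁ y₁ x₂ y₂) (ht₀ : t₀ ∈ 𝕋)
    (hper : IsEquationPeriod 𝕋 p q T)
    (hsum : ((x₁ (t₀ + T) + y₂ (t₀ + T) : ℝ) : ℂ) = ρ₁ + ρ₂)
    (hprod : ((x₁ (t₀ + T) * y₂ (t₀ + T) - x₂ (t₀ + T) * y₁ (t₀ + T) : ℝ) : ℂ) = ρ₁ * ρ₂)
    (h₁ : 1 < ‖ρ₁‖) (s : ℝ) : ¬ IsStableFrom 𝕋 p q s := by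
  intro hst
  have hub := hT.not_bddAbove ⟨t₀, ht₀⟩
  obtain ⟨δ, hδ, hstab⟩ := hst 1 one_pos
  -- by linearity, stability bounds every solution on the whole time scale
  have hbdd : ∀ x y, IsSolution 𝕋 p q x y → ∃ K, ∀ t ∈ 𝕋, s ≤ t → |x t| ≤ K ∧ |y t| ≤ K := by
    intro x y h
    set m := |x s| + |y s| + 1 with hm
    have hm0 : 0 < m := by positivity
    have hc0 : 0 < δ / m := by positivity
    have hsmall : ∀ z : ℝ → ℝ, |z s| < m → |δ / m * z s + 0 * z s| < δ := by
      intro z hz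
      rw [zero_mul, add_zero, abs_mul, abs_of_pos hc0]
      calc δ / m * |z s| < δ / m * m := by gcongr
        _ = δ := by field_simp
    have hb := hstab _ _ ((h.linearCombination h (δ / m) 0).restrict_Ici hub s)
      (hsmall x (by linarith [abs_nonneg (y s)])) (hsmall y (by linarith [abs_nonneg (x s)]))
    refine ⟨m / δ, fun t ht hst => ?_⟩
    have := hb t ht hst
    simp only [zero_mul, add_zero, abs_mul, abs_of_pos hc0] at this
    constructor
    · rw [le_div_iff₀ hδ]
      have := this.1
      rw [div_mul_eq_mul_div, div_lt_one hm0] at this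
      linarith
    · rw [le_div_iff₀ hδ]
      have := this.2
      rw [div_mul_eq_mul_div, div_lt_one hm0] at this
      linarith
  have hTpos := hT.pos
  have hmem : ∀ n : ℕ, t₀ + n * T ∈ 𝕋 := fun n => (hper.nat_mul n).add_mem t₀ ht₀
  have hlarge : ∀ᶠ n : ℕ in atTop, s ≤ t₀ + n * T := by
    obtain ⟨k, hk⟩ := exists_nat_ge ((s - t₀) / T)
    rw [div_le_iff₀ hT.pos] at hk
    filter_upwards [eventually_ge_atTop k] with n hn
    have : (k : ℝ) * T ≤ n * T := by gcongr
    linarith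
  have hgeom : ∀ z : ℝ → ℝ, (∃ K, ∀ t ∈ 𝕋, s ≤ t → |z t| ≤ K) →
      (∀ t ∈ 𝕋, t₀ ≤ t → z (t + T + T) = (x₁ (t₀ + T) + y₂ (t₀ + T)) * z (t + T) -
        (x₁ (t₀ + T) * y₂ (t₀ + T) - x₂ (t₀ + T) * y₁ (t₀ + T)) * z t) →
      ∀ n : ℕ, (z (t₀ + (n + 1 : ℕ) * T) : ℂ) = ρ₂ * z (t₀ + n * T) := by
    rintro z ⟨K, hK⟩ hrec
    refine eq_mul_of_recurrence_of_bounded (a := fun n : ℕ => (z (t₀ + n * T) : ℂ)) h₁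
      (fun n => ?_) (K := K) ?_
    · have := hrec _ (hmem n) (le_add_of_nonneg_right (by positivity))
      have c1 : ∀ n : ℕ, t₀ + n * T + T = t₀ + (n + 1 : ℕ) * T := fun n => by push_cast; ring
      rw [c1, c1] at this
      rw [← hsum, ← hprod, ← Complex.ofReal_mul, ← Complex.ofReal_mul, ← Complex.ofReal_sub]
      exact congrArg _ this
    · filter_upwards [hlarge] with n hn
      simpa using hK _ (hmem n) hn
  have hrec := fun {x y : ℝ → ℝ} (h : IsSolution 𝕋 p q x y) (t : ℝ) (ht : t ∈ 𝕋) (htt : t₀ ≤ t) =>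
    hΦ.recurrence hc hub hp hq ht₀ hT.pos.le hper 0 (by simp) (h.restrict_Ici hub t₀) ht
      (by simpa using htt)
  obtain ⟨K, hK⟩ := hbdd _ _ hΦ.isSolution₁
  obtain ⟨K', hK'⟩ := hbdd _ _ hΦ.isSolution₂
  have g1 := hgeom x₁ ⟨K, fun t ht h => (hK t ht h).1⟩
    fun t ht h => (hrec hΦ.isSolution₁ t ht h).1
  have g2 := hgeom y₂ ⟨K', fun t ht h => (hK' t ht h).2⟩
    fun t ht h => (hrec hΦ.isSolution₂ t ht h).2
  -- so both diagonal entries of the monodromy matrix equal `ρ₂`, and its trace forces `ρ₁ = ρ₂`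
  have e1 := g1 0
  have e2 := g2 0
  simp only [zero_add, Nat.cast_one, one_mul, Nat.cast_zero, zero_mul, add_zero, hΦ.x₁_init,
    hΦ.y₂_init, Complex.ofReal_one, mul_one] at e1 e2
  have hρ : ρ₁ = ρ₂ := by
    rw [Complex.ofReal_add, e1, e2] at hsum
    exact (add_right_cancel hsum).symm
  have hpow : ∀ n : ℕ, (x₁ (t₀ + n * T) : ℂ) = ρ₁ ^ n * 1 := by
    intro n
    induction n with
    | zero => simp [hΦ.x₁_init]
    | succ n ih => rw [g1, ih, hρ]; ring
  refine one_ne_zero (eq_zero_of_eventually_norm_pow_mul_le (c := 1) (K := K) h₁ ?_)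
  filter_upwards [hlarge] with n hn
  rw [← hpow, Complex.norm_real]
  exact (hK _ (hmem n) hn).1

end Stability

/-! ### The Floquet multipliers -/

lemma Matrix.charpoly_roots_eq_pair {R : Type*} [CommRing R] [IsDomain R]
    {M : Matrix (Fin 2) (Fin 2) R} {a b : R} (htr : M.trace = a + b) (hdet : M.det = a * b) :
    M.charpoly.roots = {a, b} := by
  have h : M.charpoly = (Polynomial.X - Polynomial.C a) * (Polynomial.X - Polynomial.C b) := by
    rw [Matrix.charpoly_fin_two, htr, hdet, map_add, map_mul]
    ring
  rw [h, Polynomial.roots_mul (mul_ne_zero (Polynomial.X_sub_C_ne_zero a)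
    (Polynomial.X_sub_C_ne_zero b)), Polynomial.roots_X_sub_C, Polynomial.roots_X_sub_C]
  rfl

theorem theorem3p1 (𝕋 : Set ℝ) (T t₀ : ℝ) (p q : ℝ → ℝ)
    (h𝕋 : IsTimeScale 𝕋) (hT : IsPeriodicTimeScale 𝕋 T) (ht₀ : t₀ ∈ 𝕋)
    (hp : RdContinuous 𝕋 p) (hq : RdContinuous 𝕋 q)
    (hpT : ∀ t ∈ 𝕋, p (t + T) = p t) (hqT : ∀ t ∈ 𝕋, q (t + T) = q t)
    (hreg : ∀ t ∈ 𝕋, 1 - graininess 𝕋 t * p t + graininess 𝕋 t ^ 2 * q t ≠ 0)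
    -- the two columns of the transition matrix `Φ(·, t₀)`
    (x₁ y₁ x₂ y₂ : ℝ → ℝ)
    (h₁ : IsSolution 𝕋 p q x₁ y₁) (hx₁ : x₁ t₀ = 1) (hy₁ : y₁ t₀ = 0)
    (h₂ : IsSolution 𝕋 p q x₂ y₂) (hx₂ : x₂ t₀ = 0) (hy₂ : y₂ t₀ = 1)
    (M : Matrix (Fin 2) (Fin 2) ℝ)
    (hM : M = !![x₁ (t₀ + T), x₂ (t₀ + T); y₁ (t₀ + T), y₂ (t₀ + T)])
    (A B ρ₁ ρ₂ : ℂ)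
    (hA : A = ((x₁ (t₀ + T) + y₂ (t₀ + T) : ℝ) : ℂ))
    (hB : B = timeScaleExp 𝕋 (fun t => -p t + graininess 𝕋 t * q t) (t₀ + T) t₀)
    (hρ₁ : ρ₁ = A / 2 + Complex.sqrt ((A / 2) ^ 2 - B))
    (hρ₂ : ρ₂ = A / 2 - Complex.sqrt ((A / 2) ^ 2 - B)) :
    (A = (M.trace : ℂ) ∧ B = (M.det : ℂ) ∧
      (M.map (fun a : ℝ => (a : ℂ))).charpoly.roots = {ρ₁, ρ₂}) ∧
    (‖ρ₁‖ < 1 ∧ ‖ρ₂‖ < 1 → ∀ s ∈ 𝕋, IsStableFrom 𝕋 p q s) ∧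
    (1 < ‖ρ₁‖ ∨ 1 < ‖ρ₂‖ → ∀ s ∈ 𝕋, ¬ IsStableFrom 𝕋 p q s) := by

  have hc := h𝕋.isClosed
  have hub := hT.not_bddAbove ⟨t₀, ht₀⟩
  have hp' := hp.hasRdLimits
  have hq' := hq.hasRdLimits
  have hΦ : IsFundamentalSystem 𝕋 p q t₀ x₁ y₁ x₂ y₂ := ⟨h₁, h₂, hx₁, hy₁, hx₂, hy₂⟩
  have hper : IsEquationPeriod 𝕋 p q T :=
    ⟨hT.add_mem, fun t ht => (hT.graininess_add t ht).symm, hpT, hqT⟩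
  have hLiouville := eq_timeScaleExp_mul hc hub
    (hp'.neg.add ((HasRdLimits.graininess hub).mul hq'))
    (fun t ht h => hreg t ht (by linear_combination h))
    (fun t ht => h₁.hasDeltaDerivAt_wronskian hub h₂ ht) ht₀ (hT.add_mem t₀ ht₀)
    (le_add_of_nonneg_right hT.pos.le)
  rw [hx₁, hx₂, hy₁, hy₂, mul_one, mul_zero, sub_zero, Complex.ofReal_one, mul_one, ← hB]
    at hLiouville
  have htr : A = (M.trace : ℂ) := by rw [hA, hM, Matrix.trace_fin_two_of]
  have hdet : B = (M.det : ℂ) := by rw [← hLiouville, hM, Matrix.det_fin_two_of]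
  have hsqrt : Complex.sqrt ((A / 2) ^ 2 - B) ^ 2 = (A / 2) ^ 2 - B :=
    Complex.cpow_nat_inv_pow _ two_ne_zero
  have hsum : A = ρ₁ + ρ₂ := by rw [hρ₁, hρ₂]; ring
  have hprod : B = ρ₁ * ρ₂ := by
    rw [hρ₁, hρ₂]
    linear_combination hsqrt
  refine ⟨⟨htr, hdet, ?_⟩, ?_, ?_⟩
  · refine Matrix.charpoly_roots_eq_pair ?_ ?_
    · rw [← hsum, htr]
      exact (AddMonoidHom.map_trace Complex.ofRealHom.toAddMonoidHom M).symm
    · rw [← hprod, hdet]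
      exact (RingHom.map_det Complex.ofRealHom M).symm
  · rintro ⟨h₁', h₂'⟩ s hs
    exact isStableFrom_of_norm_lt_one hc hT hp' hq' hΦ ht₀ hper (hA ▸ hsum)
      (hLiouville.trans hprod) h₁' h₂' hs
  · rintro (h | h) s -
    · exact not_isStableFrom_of_one_lt_norm hc hT hp' hq' hΦ ht₀ hper (hA ▸ hsum)
        (hLiouville.trans hprod) h s
    · exact not_isStableFrom_of_one_lt_norm hc hT hp' hq' hΦ ht₀ hper
        (hA ▸ hsum.trans (add_comm _ _)) (hLiouville.trans (hprod.trans (mul_comm _ _))) h s
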